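/- For a permutation $\sigma\in S_n$ let $\mathrm{sh}(\sigma)$ be its Robinson--Schensted shape (the shape of its row-insertion tableau). For a partition $\lambda\vdash n$ let $W_\lambda$ be the set of $\sigma\in S_n$ with $\mathrm{sh}(\sigma)=\lambda$, and for an integer $\Delta\ge 0$ let $W_\lambda^\Delta$ be the set of those $\sigma\in W_\lambda$ having exactly $\Delta$ more inversions than the minimal number of inversions among elements of $W_\lambda$. The elements of $W_\lambda^0$ are called minimal permutations. Suppose the conjugate of $\lambda$ has exactly two parts, $\lambda'=(s,r)$ with $s\ge r\ge 1$. Each minimal permutation $\pi$ of shape $\lambda$ has one-line notation $(c_1,\dots,2,1\,|\,n,n-1,\dots,c_1+1)$ for a unique $(c_1,c_2)$ with $c_1,c_2>0$ and $c_1+c_2=n$. A jump partition for $\pi$ of size $|J|=\Delta$ is a pair $J=(\mu,\nu)$ of (possibly empty) integer partitions with $|\mu|+|\nu|=\Delta$, $\ell(\mu)\le c_1$, $\ell(\nu)\le c_1$, $\mu_1<c_2$, $\nu_1<c_2$ (the first part of the empty partition being $0$). Let $s_i\in S_n$ denote the adjacent transposition of $i$ and $i+1$, and for a partition $\mu$ with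 $\ell=\ell(\mu)$ parts put $$w_\mu=(s_{c_1}s_{c_1+1}\cdots s_{c_1-1+\mu_1})\,(s_{c_1-1}\cdots s_{c_1-2+\mu_2})\cdots(s_{c_1-\ell+1}\cdots s_{c_1-\ell+\mu_\ell}).$$ The jump partition acts by $J(\pi)=w_\nu^{-1}\,\pi\,w_\mu$, where products are compositions of functions (so right multiplication by $s_i$ exchanges the entries in positions $i,i+1$, and left multiplication exchanges the values $i,i+1$). $J$ is valid for $\pi$ if $\mathrm{sh}(J(\pi))=\mathrm{sh}(\pi)$. Theorem. Let $\lambda\vdash n$ with $\lambda'=(s,r)$, let $0\le\Delta<r$, and let $\sigma\in W_\lambda^\Delta$. Then there is a unique pair $(\pi,J)$ such that $\pi\in W_\lambda^0$, $J$ is a valid jump partition for $\pi$ of size $|J|=\Delta$, and $\sigma=J(\pi)$. -/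

import Mathlib

namespace TwoColumn

/-- Schensted insertion of `x` into an increasing row: `x` replaces the leftmost (i.e. smallest)
entry larger than `x`, which is returned; if there is none, `x` is appended to the row. -/
def rowInsert {α : Type*} [LinearOrder α] (x : α) : List α → List α × Option α
  | [] => ([x], none)
  | y :: ys =>
    if x < y then (x :: ys, some y)
    else (y :: (rowInsert x ys).1, (rowInsert x ys).2)

/-- Row insertion `T ← x` of `x` into a tableau `T`, given as the list of its rows: the entry bumped
from a row is inserted into the next row. -/
def tableauInsert {α : Type*} [LinearOrder α] : List (List α) → α → List (List α)
  | [], x => [[x]]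
  | row :: rows, x =>
    match (rowInsert x row).2 with
    | none => (rowInsert x row).1 :: rows
    | some y => (rowInsert x row).1 :: tableauInsert rows y

/-- The insertion tableau `P` of a permutation: insert `σ 0, σ 1, …` successively, starting from
the empty tableau. -/
def insertionTableau {n : ℕ} (σ : Equiv.Perm (Fin n)) : List (List (Fin n)) :=
  (List.ofFn σ).foldl tableauInsert []

/-- The Robinson-Schensted shape of a permutation, as the list of row lengths of its insertion
tableau. -/
def shape {n : ℕ} (σ : Equiv.Perm (Fin n)) : List ℕ :=
  (insertionTableau σ).map List.length

/-- The number of inversions. -/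
def inv {n : ℕ} (σ : Equiv.Perm (Fin n)) : ℕ :=
  (Finset.univ.filter fun p : Fin n × Fin n => p.1 < p.2 ∧ σ p.2 < σ p.1).card

/-- `W_λ`: the permutations of `n` letters with shape `lam`. -/
def permsOfShape (n : ℕ) (lam : YoungDiagram) : Set (Equiv.Perm (Fin n)) :=
  {σ | shape σ = lam.rowLens}

/-- The minimal number of inversions of a permutation with shape `lam`. -/
noncomputable def minInv (n : ℕ) (lam : YoungDiagram) : ℕ :=
  sInf (inv '' permsOfShape n lam)

/-- `W_λ^Δ`: the permutations with shape `lam` having exactly `Δ` more inversions than the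
minimal ones. In particular `W_λ^0` is the set of minimal permutations of shape `lam`. -/
def permsOfShapeExtra (n : ℕ) (lam : YoungDiagram) (Δ : ℕ) : Set (Equiv.Perm (Fin n)) :=
  {σ | σ ∈ permsOfShape n lam ∧ inv σ = minInv n lam + Δ}

/-- `π` corresponds to the composition `(c₁, c₂)` of `n`: with positions and values numbered from
`1`, its one-line notation is `(c₁, …, 2, 1 | n, n - 1, …, c₁ + 1)`. (Here positions and values are
numbered from `0`.) -/
def CorrespondsTo {n : ℕ} (π : Equiv.Perm (Fin n)) (c₁ c₂ : ℕ) : Prop :=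
  0 < c₁ ∧ 0 < c₂ ∧ c₁ + c₂ = n ∧
    ∀ i : Fin n,
      ((i : ℕ) < c₁ → (π i : ℕ) + i + 1 = c₁) ∧
      (c₁ ≤ (i : ℕ) → (π i : ℕ) + i + 1 = c₁ + n)

/-- The adjacent transposition `s_i`, for `1 ≤ i ≤ n - 1`, interchanging the `i`-th and `(i+1)`-st
letters (numbered from `1`); it is `1` for `i` out of range. -/
def adjSwap (n i : ℕ) : Equiv.Perm (Fin n) :=
  if h : 1 ≤ i ∧ i < n then Equiv.swap ⟨i - 1, by omega⟩ ⟨i, h.2⟩ else 1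

/-- The product
`(s_c ⋯ s_{c-1+μ₁}) (s_{c-1} ⋯ s_{c-2+μ₂}) ⋯ (s_{c-ℓ+1} ⋯ s_{c-ℓ+μ_ℓ})`, where `ℓ = ℓ(μ)`. -/
def innerProd (n c : ℕ) (μ : YoungDiagram) : Equiv.Perm (Fin n) :=
  ((List.range (μ.colLen 0)).map fun i =>
    ((List.range (μ.rowLen i)).map fun j => adjSwap n (c - i + j)).prod).prod

/-- The product
`(s_{c-ℓ+ν_ℓ} ⋯ s_{c-ℓ+1}) ⋯ (s_{c-2+ν₂} ⋯ s_{c-1}) (s_{c-1+ν₁} ⋯ s_c)`, where `ℓ = ℓ(ν)`. -/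
def outerProd (n c : ℕ) (ν : YoungDiagram) : Equiv.Perm (Fin n) :=
  ((List.range (ν.colLen 0)).reverse.map fun i =>
    ((List.range (ν.rowLen i)).reverse.map fun j => adjSwap n (c - i + j)).prod).prod

/-- A pair `(μ, ν)` of partitions: the data of a jump partition in the two-column case. -/
@[ext]
structure PartitionPair where
  /-- the inner partition `μ` -/
  inner : YoungDiagram
  /-- the outer partition `ν` -/
  outer : YoungDiagram

namespace PartitionPair

/-- `|J| = |μ| + |ν|`. -/
def size (J : PartitionPair) : ℕ := J.inner.card + J.outer.card

/-- `J` is a jump partition for the minimal permutation corresponding to `(c₁, c₂)`: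
`ℓ(μ), ℓ(ν) ≤ c₁` and `μ₁, ν₁ < c₂`. -/
def IsJumpPartition (J : PartitionPair) (c₁ c₂ : ℕ) : Prop :=
  (J.inner.colLen 0 ≤ c₁ ∧ J.inner.rowLen 0 < c₂) ∧
  (J.outer.colLen 0 ≤ c₁ ∧ J.outer.rowLen 0 < c₂)

/-- `J(π) = ν ∘ π ∘ μ`, for `π` with first block of length `c₁`. -/
def act {n : ℕ} (J : PartitionPair) (c₁ : ℕ) (π : Equiv.Perm (Fin n)) : Equiv.Perm (Fin n) :=
  outerProd n c₁ J.outer * (π * innerProd n c₁ J.inner)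

end PartitionPair

/-- `J` is a valid jump partition of size `Δ` for `π` (i.e. `J(π)` has the same shape as `π`), and
`σ = J(π)`. The composition `(c₁, c₂)` is determined by `π`, as `c₁` is the first entry of its
one-line notation. -/
def IsValidJump {n : ℕ} (π : Equiv.Perm (Fin n)) (J : PartitionPair) (Δ : ℕ)
    (σ : Equiv.Perm (Fin n)) : Prop :=
  ∃ c₁ c₂ : ℕ, CorrespondsTo π c₁ c₂ ∧ J.IsJumpPartition c₁ c₂ ∧ J.size = Δ ∧
    shape (J.act c₁ π) = shape π ∧ σ = J.act c₁ π

end TwoColumn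

/-! A permutation of two-column shape has no increasing subsequence of length three. Hence its
left-to-right minima ("bottoms") and its remaining entries ("tops") form two decreasing sequences,
and every noninversion runs from a bottom to a top. Inversions and noninversions (`coinv`) add up to
all pairs, so few inversions means many noninversions.

By Schensted's theorem the number s of rows is the length of a longest decreasing subsequence S. No
noninversion lies inside S; counting the other bottom-top pairs gives coinv ≤ rs, and a defect below
r forces the numbers of bottoms and tops to be r and s in some order (`Avoids123.coinv_bounds`). The
layered permutations attain rs, so σ ∈ W_λ^Δ means coinv σ = rs − Δ (`mem_permsOfShapeExtra_iff`).

Existence: let μ consist of the pairs (bottom, top) with the top to the left, and ν of those with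
the top smaller in value. The products w_μ and w_ν realise exactly these displacements, so J(π) = σ
for the layered π with the same block sizes (`IsSplit.act_jump`). Each of the c₁c₂ = rs pairs lies
in exactly one of μ, ν and the set of noninversions, so |J| = Δ (`IsSplit.size_jump_add_coinv`).

Uniqueness: since Δ < r ≤ min(c₁, c₂), the two diagrams are too small to destroy all noninversions
at any entry. So the displaced first block of π is the set of left-to-right minima of J(π)
(`mem_leftMinima_act`), and its positions and values determine π, μ and ν (`jump_unique`). -/

namespace TwoColumn

/-! ### Knuth relations and chains in words -/

section Words

variable {α : Type*}

/-- Every `R`-chain which is a subword of `u` can be exchanged for an `R`-chain of the same length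
which is a subword of `v` and fits between the same elements. -/
def ChainEmb (R : α → α → Prop) (u v : List α) : Prop :=
  ∀ l : List α, l.Sublist u → l.Pairwise R → ∃ l' : List α, l'.Sublist v ∧ l'.Pairwise R ∧
    l'.length = l.length ∧ (∀ a, (∀ b ∈ l, R a b) → ∀ b ∈ l', R a b) ∧
    (∀ a, (∀ b ∈ l, R b a) → ∀ b ∈ l', R b a)

theorem ChainEmb.refl (R : α → α → Prop) (u : List α) : ChainEmb R u u :=
  fun l hl hp => ⟨l, hl, hp, rfl, fun _ h => h, fun _ h => h⟩

theorem ChainEmb.trans {R : α → α → Prop} {u v w : List α} (h₁ : ChainEmb R u v)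
    (h₂ : ChainEmb R v w) : ChainEmb R u w := by
  intro l hl hp
  obtain ⟨l', hl', hp', hn', ha', hb'⟩ := h₁ l hl hp
  obtain ⟨l'', hl'', hp'', hn'', ha'', hb''⟩ := h₂ l' hl' hp'
  exact ⟨l'', hl'', hp'', hn''.trans hn', fun a h => ha'' a (ha' a h), fun a h => hb'' a (hb' a h)⟩

/-- The two comparison clauses of `ChainEmb` are what allows the exchanged piece to be glued to the
parts of the chain in `p` and `q`. -/
theorem ChainEmb.append {R : α → α → Prop} {u v : List α} (h : ChainEmb R u v) (p q : List α) :
    ChainEmb R (p ++ u ++ q) (p ++ v ++ q) := by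
  intro l hl hp
  obtain ⟨l₁₂, l₃, rfl, hl₁₂, hl₃⟩ := List.sublist_append_iff.1 hl
  obtain ⟨l₁, l₂, rfl, hl₁, hl₂⟩ := List.sublist_append_iff.1 hl₁₂
  simp only [List.pairwise_append, List.mem_append] at hp
  obtain ⟨⟨hp₁, hp₂, h₁₂⟩, hp₃, h₃⟩ := hp
  obtain ⟨l', hl', hp', hn, ha, hb⟩ := h l₂ hl₂ hp₂
  refine ⟨l₁ ++ l' ++ l₃, (hl₁.append hl').append hl₃, ?_, by simp [hn], ?_, ?_⟩
  · simp only [List.pairwise_append, List.mem_append]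
    refine ⟨⟨hp₁, hp', fun a hA => ha a (h₁₂ a hA)⟩, hp₃, ?_⟩
    rintro a (hA | hA) b hB
    · exact h₃ a (.inl hA) b hB
    · exact hb b (fun c hC => h₃ c (.inr hC) b hB) a hA
  · intro a hA b hB
    simp only [List.mem_append] at hA hB
    rcases hB with (hB | hB) | hB
    · exact hA b (.inl (.inl hB))
    · exact ha a (fun c hC => hA c (.inl (.inr hC))) b hB
    · exact hA b (.inr hB)
  · intro a hA b hB
    simp only [List.mem_append] at hA hB
    rcases hB with (hB | hB) | hB
    · exact hA b (.inl (.inl hB))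
    · exact hb a (fun c hC => hA c (.inl (.inr hC))) b hB
    · exact hA b (.inr hB)

theorem sublist_triple {l : List α} {x y z : α} (h : l.Sublist [x, y, z]) :
    l = [] ∨ l = [x] ∨ l = [y] ∨ l = [z] ∨ l = [x, y] ∨ l = [x, z] ∨ l = [y, z] ∨
      l = [x, y, z] := by
  have := List.mem_sublists.2 h
  simp [List.sublists] at this
  tauto

theorem chainEmb_of_exchange {R : α → α → Prop} {u v : List α} {p q p' q' : α}
    (h : ∀ l : List α, l.Sublist u → l.Pairwise R → l.Sublist v ∨ l = [p, q])
    (hs : [p', q'].Sublist v) (hR : R p' q')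
    (hb : ∀ a, (R a p → R a q → R a p' ∧ R a q') ∧ (R p a → R q a → R p' a ∧ R q' a)) :
    ChainEmb R u v := by
  intro l hl hp
  rcases h l hl hp with h | rfl
  · exact ⟨l, h, hp, rfl, fun _ h => h, fun _ h => h⟩
  · refine ⟨[p', q'], hs, by simpa using hR, rfl, ?_, ?_⟩
    · intro a ha
      simpa using (hb a).1 (ha p (by simp)) (ha q (by simp))
    · intro a ha
      simpa using (hb a).2 (ha p (by simp)) (ha q (by simp))

variable [LinearOrder α]

/-- Words with interchangeable weakly increasing and strictly decreasing subwords. -/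
def ChainEquiv (u v : List α) : Prop :=
  (ChainEmb (· ≤ ·) u v ∧ ChainEmb (· ≤ ·) v u) ∧ (ChainEmb (· > ·) u v ∧ ChainEmb (· > ·) v u)

theorem ChainEquiv.refl (u : List α) : ChainEquiv u u :=
  ⟨⟨.refl _ _, .refl _ _⟩, ⟨.refl _ _, .refl _ _⟩⟩

theorem ChainEquiv.trans {u v w : List α} (h₁ : ChainEquiv u v) (h₂ : ChainEquiv v w) :
    ChainEquiv u w :=
  ⟨⟨h₁.1.1.trans h₂.1.1, h₂.1.2.trans h₁.1.2⟩, ⟨h₁.2.1.trans h₂.2.1, h₂.2.2.trans h₁.2.2⟩⟩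

theorem ChainEquiv.append {u v : List α} (h : ChainEquiv u v) (p q : List α) :
    ChainEquiv (p ++ u ++ q) (p ++ v ++ q) :=
  ⟨⟨h.1.1.append p q, h.1.2.append p q⟩, ⟨h.2.1.append p q, h.2.2.append p q⟩⟩

theorem ChainEquiv.append_left {u v : List α} (h : ChainEquiv u v) (p : List α) :
    ChainEquiv (p ++ u) (p ++ v) := by
  simpa using h.append p []

theorem ChainEquiv.append_right {u v : List α} (h : ChainEquiv u v) (q : List α) :
    ChainEquiv (u ++ q) (v ++ q) := by
  simpa using h.append [] q

/-- A Knuth relation. The only chains of length two lost are x ≤ z, replaced by y ≤ z, and z > x,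
replaced by y > x. -/
theorem chainEquiv_middle_first {x y z : α} (hxy : x < y) (hyz : y ≤ z) :
    ChainEquiv [y, z, x] [y, x, z] := by
  refine ⟨⟨?_, ?_⟩, ?_, ?_⟩
  · refine chainEmb_of_exchange (p := y) (q := z) (p' := y) (q' := z) ?_ (by simp) hyz (by tauto)
    intro l hl hp
    rcases sublist_triple hl with rfl | rfl | rfl | rfl | rfl | rfl | rfl | rfl <;>
      simp_all <;> grind
  · refine chainEmb_of_exchange (p := x) (q := z) (p' := y) (q' := z) ?_ (by simp) hyz ?_
    · intro l hl hp
      rcases sublist_triple hl with rfl | rfl | rfl | rfl | rfl | rfl | rfl | rfl <;>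
        simp_all <;> grind
    · grind
  · refine chainEmb_of_exchange (p := z) (q := x) (p' := y) (q' := x) ?_ (by simp) hxy ?_
    · intro l hl hp
      rcases sublist_triple hl with rfl | rfl | rfl | rfl | rfl | rfl | rfl | rfl <;>
        simp_all <;> grind
    · grind
  · refine chainEmb_of_exchange (p := y) (q := x) (p' := y) (q' := x) ?_ (by simp) hxy (by tauto)
    intro l hl hp
    rcases sublist_triple hl with rfl | rfl | rfl | rfl | rfl | rfl | rfl | rfl <;>
      simp_all <;> grind

/-- The other Knuth relation: x ≤ z is replaced by x ≤ y, and z > x by z > y. -/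
theorem chainEquiv_middle_last {x y z : α} (hxy : x ≤ y) (hyz : y < z) :
    ChainEquiv [x, z, y] [z, x, y] := by
  refine ⟨⟨?_, ?_⟩, ?_, ?_⟩
  · refine chainEmb_of_exchange (p := x) (q := z) (p' := x) (q' := y) ?_ (by simp) hxy ?_
    · intro l hl hp
      rcases sublist_triple hl with rfl | rfl | rfl | rfl | rfl | rfl | rfl | rfl <;>
        simp_all <;> grind
    · grind
  · refine chainEmb_of_exchange (p := x) (q := y) (p' := x) (q' := y) ?_ (by simp) hxy (by tauto)
    intro l hl hp
    rcases sublist_triple hl with rfl | rfl | rfl | rfl | rfl | rfl | rfl | rfl <;>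
      simp_all <;> grind
  · refine chainEmb_of_exchange (p := z) (q := y) (p' := z) (q' := y) ?_ (by simp) hyz (by tauto)
    intro l hl hp
    rcases sublist_triple hl with rfl | rfl | rfl | rfl | rfl | rfl | rfl | rfl <;>
      simp_all <;> grind
  · refine chainEmb_of_exchange (p := z) (q := x) (p' := z) (q' := y) ?_ (by simp) hyz ?_
    · intro l hl hp
      rcases sublist_triple hl with rfl | rfl | rfl | rfl | rfl | rfl | rfl | rfl <;>
        simp_all <;> grind
    · grind

/-! ### Row insertion, tableaux and decreasing subwords -/

theorem lt_of_rowInsert_eq_some {x b : α} {row : List α} (h : (rowInsert x row).2 = some b) :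
    x < b ∧ b ∈ row := by
  induction row with
  | nil => simp [rowInsert] at h
  | cons y ys ih =>
    by_cases hxy : x < y
    · simp only [rowInsert, hxy, if_true, Option.some.injEq] at h
      subst h
      exact ⟨hxy, by simp⟩
    · simp only [rowInsert, hxy, if_false] at h
      exact ⟨(ih h).1, List.mem_cons_of_mem _ (ih h).2⟩

theorem mem_of_mem_rowInsert {x a : α} {row : List α} (h : a ∈ (rowInsert x row).1) :
    a = x ∨ a ∈ row := by
  induction row with
  | nil => simpa [rowInsert] using h
  | cons y ys ih =>
    by_cases hxy : x < y
    · simp only [rowInsert, hxy, if_true, List.mem_cons] at h ⊢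
      tauto
    · simp only [rowInsert, hxy, if_false, List.mem_cons] at h ⊢
      tauto

theorem rowInsert_ne_nil (x : α) (row : List α) : (rowInsert x row).1 ≠ [] := by
  cases row with
  | nil => simp [rowInsert]
  | cons y ys => by_cases hxy : x < y <;> simp [rowInsert, hxy]

theorem rowInsert_pairwise (x : α) {row : List α} (h : row.Pairwise (· ≤ ·)) :
    (rowInsert x row).1.Pairwise (· ≤ ·) := by
  induction row with
  | nil => simp [rowInsert]
  | cons y ys ih =>
    obtain ⟨hy, hys⟩ := List.pairwise_cons.1 h
    by_cases hxy : x < y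
    · simp only [rowInsert, hxy, if_true, List.pairwise_cons]
      exact ⟨fun a ha => hxy.le.trans (hy a ha), hys⟩
    · simp only [rowInsert, hxy, if_false, List.pairwise_cons]
      refine ⟨fun a ha => ?_, ih hys⟩
      rcases mem_of_mem_rowInsert ha with rfl | ha
      · exact not_lt.1 hxy
      · exact hy a ha

theorem head_rowInsert_lt {x b : α} {row : List α} (h : (rowInsert x row).2 = some b) :
    ∃ c t, (rowInsert x row).1 = c :: t ∧ c < b := by
  cases row with
  | nil => simp [rowInsert] at h
  | cons y ys =>
    by_cases hxy : x < y
    · simp only [rowInsert, hxy, if_true, Option.some.injEq] at h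
      subst h
      exact ⟨x, ys, by simp [rowInsert, hxy], hxy⟩
    · simp only [rowInsert, hxy, if_false] at h
      exact ⟨y, (rowInsert x ys).1, by simp [rowInsert, hxy],
        (not_lt.1 hxy).trans_lt (lt_of_rowInsert_eq_some h).1⟩

/-- The letter x travels left by Knuth moves until it stands next to y, which is then in front of
the new row, as the bumped letter should be. -/
theorem chainEquiv_cons_append_singleton {x : α} (y : α) (ys : List α)
    (h : (y :: ys).Pairwise (· ≤ ·)) (hx : x < y) :
    ChainEquiv (y :: ys ++ [x]) (y :: x :: ys) := by
  induction ys generalizing y with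
  | nil => exact .refl _
  | cons z zs ih =>
    obtain ⟨hy, hzs⟩ := List.pairwise_cons.1 h
    have hyz := hy z (by simp)
    exact ((ih z hzs (hx.trans_le hyz)).append_left [y]).trans
      ((chainEquiv_middle_first hx hyz).append_right zs)

theorem chainEquiv_rowInsert (x : α) (row : List α) (h : row.Pairwise (· ≤ ·)) :
    ChainEquiv (row ++ [x]) ((rowInsert x row).2.toList ++ (rowInsert x row).1) := by
  induction row with
  | nil => exact .refl _
  | cons y ys ih =>
    obtain ⟨hy, hys⟩ := List.pairwise_cons.1 h
    by_cases hxy : x < y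
    · simpa [rowInsert, hxy] using chainEquiv_cons_append_singleton y ys h hxy
    · have ih := (ih hys).append_left [y]
      have hs := rowInsert_pairwise x h
      simp only [rowInsert, hxy, if_false] at hs ⊢
      cases hb : (rowInsert x ys).2 with
      | none => simpa [hb] using ih
      | some b =>
        -- The letter c following y in the new row satisfies y ≤ c < b, so a Knuth move carries the
        -- bumped b to the left across y.
        obtain ⟨c, t, hc, hcb⟩ := head_rowInsert_lt hb
        rw [hb] at ih
        rw [hc] at ih hs ⊢
        exact ih.trans ((chainEquiv_middle_last ((List.pairwise_cons.1 hs).1 c (by simp))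
          hcb).append_right t)

/-- The reading word of a tableau: its rows from bottom to top. -/
def readingWord : List (List α) → List α
  | [] => []
  | row :: rows => readingWord rows ++ row

/-- `u` lies strictly above `v` and is at least as long. -/
def RowAbove : List α → List α → Prop
  | _, [] => True
  | [], _ :: _ => False
  | x :: xs, y :: ys => x < y ∧ RowAbove xs ys

/-- Semistandard tableaux. -/
structure IsTableau (T : List (List α)) : Prop where
  ne_nil : ∀ row ∈ T, row ≠ []
  pairwise : ∀ row ∈ T, row.Pairwise (· ≤ ·)
  isChain : T.IsChain RowAbove

theorem chainEquiv_tableauInsert (T : List (List α)) (x : α)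
    (hT : ∀ row ∈ T, row.Pairwise (· ≤ ·)) :
    ChainEquiv (readingWord T ++ [x]) (readingWord (tableauInsert T x)) := by
  induction T generalizing x with
  | nil => exact .refl _
  | cons row rows ih =>
    have h := (chainEquiv_rowInsert x row (hT row (by simp))).append_left (readingWord rows)
    cases hb : (rowInsert x row).2 with
    | none => simpa [tableauInsert, hb, readingWord] using h
    | some b =>
      have ih := (ih b fun r hr => hT r (List.mem_cons_of_mem _ hr)).append_right (rowInsert x row).1
      rw [hb] at h
      simp only [tableauInsert, hb, readingWord]
      simp only [Option.toList_some, List.append_assoc, List.cons_append, List.nil_append] at h ih ⊢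
      exact h.trans ih

theorem RowAbove.length_le {u v : List α} (h : RowAbove u v) : v.length ≤ u.length := by
  induction u generalizing v with
  | nil => cases v <;> simp_all [RowAbove]
  | cons x xs ih =>
    cases v with
    | nil => simp
    | cons y ys => simpa using ih h.2

theorem rowAbove_nil (u : List α) : RowAbove u [] := by
  cases u <;> trivial

theorem RowAbove.rowInsert {u v : List α} (x : α) (h : RowAbove u v) :
    RowAbove (rowInsert x u).1 v := by
  induction u generalizing v with
  | nil => cases v <;> simp_all [RowAbove]
  | cons y ys ih =>
    cases v with
    | nil => exact rowAbove_nil _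
    | cons z zs =>
      by_cases hxy : x < y
      · simp only [TwoColumn.rowInsert, hxy, if_true]
        exact ⟨hxy.trans h.1, h.2⟩
      · simp only [TwoColumn.rowInsert, hxy, if_false]
        exact ⟨h.1, ih h.2⟩

/-- The entry below the cell vacated by b exceeds b, so b enters the next row weakly to the left of
its old column, and columns stay strict. -/
theorem RowAbove.rowInsert_rowInsert {u v : List α} {x b : α} (h : RowAbove u v)
    (hu : u.Pairwise (· ≤ ·)) (hb : (TwoColumn.rowInsert x u).2 = some b) :
    RowAbove (TwoColumn.rowInsert x u).1 (TwoColumn.rowInsert b v).1 := by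
  induction u generalizing v with
  | nil => simp [TwoColumn.rowInsert] at hb
  | cons y ys ih =>
    obtain ⟨hy, hys⟩ := List.pairwise_cons.1 hu
    by_cases hxy : x < y
    · simp only [TwoColumn.rowInsert, hxy, if_true, Option.some.injEq] at hb ⊢
      subst hb
      cases v with
      | nil => exact ⟨hxy, rowAbove_nil _⟩
      | cons z zs =>
        simp only [TwoColumn.rowInsert, h.1, if_true]
        exact ⟨hxy, h.2⟩
    · simp only [TwoColumn.rowInsert, hxy, if_false] at hb ⊢
      have hyb : y < b := (not_lt.1 hxy).trans_lt (lt_of_rowInsert_eq_some hb).1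
      cases v with
      | nil => exact ⟨hyb, rowAbove_nil _⟩
      | cons z zs =>
        by_cases hbz : b < z
        · simp only [TwoColumn.rowInsert, hbz, if_true]
          exact ⟨hyb, h.2.rowInsert x⟩
        · simp only [TwoColumn.rowInsert, hbz, if_false]
          exact ⟨h.1, ih h.2 hys hb⟩

theorem tableauInsert_ne_nil (T : List (List α)) (x : α) :
    ∃ rows, tableauInsert T x = (rowInsert x (T.headD [])).1 :: rows := by
  cases T with
  | nil => exact ⟨[], rfl⟩
  | cons row rows =>
    simp only [tableauInsert, List.headD_cons]
    split <;> exact ⟨_, rfl⟩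

theorem IsTableau.tableauInsert {T : List (List α)} (h : IsTableau T) (x : α) :
    IsTableau (tableauInsert T x) := by
  induction T generalizing x with
  | nil => exact ⟨by simp [TwoColumn.tableauInsert], by simp [TwoColumn.tableauInsert],
      by simp [TwoColumn.tableauInsert]⟩
  | cons row rows ih =>
    have hrows : IsTableau rows := ⟨fun r hr => h.ne_nil r (by simp [hr]),
      fun r hr => h.pairwise r (by simp [hr]), h.isChain.tail⟩
    have hrow := h.pairwise row (by simp)
    have hch := h.isChain
    cases hb : (rowInsert x row).2 with
    | none =>
      simp only [TwoColumn.tableauInsert, hb]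
      refine ⟨?_, ?_, ?_⟩
      · rintro r (_ | ⟨_, hr⟩)
        exacts [rowInsert_ne_nil _ _, hrows.ne_nil r hr]
      · rintro r (_ | ⟨_, hr⟩)
        exacts [rowInsert_pairwise _ hrow, hrows.pairwise r hr]
      · cases rows with
        | nil => simp
        | cons r rs =>
          rw [List.isChain_cons_cons] at hch ⊢
          exact ⟨hch.1.rowInsert x, hch.2⟩
    | some b =>
      have ih := ih hrows b
      simp only [TwoColumn.tableauInsert, hb]
      refine ⟨?_, ?_, ?_⟩
      · rintro r (_ | ⟨_, hr⟩)
        exacts [rowInsert_ne_nil _ _, ih.ne_nil r hr]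
      · rintro r (_ | ⟨_, hr⟩)
        exacts [rowInsert_pairwise _ hrow, ih.pairwise r hr]
      · obtain ⟨rs, hrs⟩ := tableauInsert_ne_nil rows b
        have hic := ih.isChain
        rw [hrs] at hic ⊢
        rw [List.isChain_cons_cons]
        refine ⟨RowAbove.rowInsert_rowInsert ?_ hrow hb, hic⟩
        cases rows with
        | nil => exact rowAbove_nil _
        | cons r rs => exact (List.isChain_cons_cons.1 hch).1

theorem isTableau_foldl (w : List α) : IsTableau (w.foldl tableauInsert []) := by
  induction w using List.reverseRecOn with
  | nil => exact ⟨by simp, by simp, by simp⟩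
  | append_singleton w x ih => simpa using ih.tableauInsert x

theorem chainEquiv_foldl (w : List α) :
    ChainEquiv w (readingWord (w.foldl tableauInsert [])) := by
  induction w using List.reverseRecOn with
  | nil => exact .refl _
  | append_singleton w x ih =>
    simpa using (ih.append_right [x]).trans
      (chainEquiv_tableauInsert _ x (isTableau_foldl w).pairwise)

/-- Rows are weakly increasing, so a strictly decreasing subword takes at most one letter from each.
-/
theorem length_le_of_sublist_readingWord {T : List (List α)} (hT : IsTableau T) {l : List α}
    (hl : l.Sublist (readingWord T)) (hp : l.Pairwise (· > ·)) : l.length ≤ T.length := by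
  induction T generalizing l with
  | nil => simpa [readingWord] using hl
  | cons row rows ih =>
    have hrows : IsTableau rows := ⟨fun r hr => hT.ne_nil r (by simp [hr]),
      fun r hr => hT.pairwise r (by simp [hr]), hT.isChain.tail⟩
    obtain ⟨l₁, l₂, rfl, h₁, h₂⟩ := List.sublist_append_iff.1 hl
    have hp' := List.pairwise_append.1 hp
    have := ih hrows h₁ hp'.1
    have h₃ := (hT.pairwise row (by simp)).sublist h₂
    have : l₂.length ≤ 1 := by
      match l₂, hp'.2.1, h₃ with
      | [], _, _ => simp
      | [_], _, _ => simp
      | a :: b :: _, h, h' => simp at h h'; exact absurd h.1.1 (not_lt.2 h'.1.1)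
    simp
    omega

/-- The first column, read upwards, is such a subword. The last clause, bounding it below by the
corner entry, keeps the induction going. -/
theorem exists_sublist_readingWord {T : List (List α)} (hT : IsTableau T) :
    ∃ l : List α, l.Sublist (readingWord T) ∧ l.Pairwise (· > ·) ∧ l.length = T.length ∧
      ∀ a row rows, T = (a :: row) :: rows → ∀ b ∈ l, a ≤ b := by
  induction T with
  | nil => exact ⟨[], by simp⟩
  | cons row rows ih =>
    have hrows : IsTableau rows := ⟨fun r hr => hT.ne_nil r (by simp [hr]),
      fun r hr => hT.pairwise r (by simp [hr]), hT.isChain.tail⟩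
    obtain ⟨l, hl, hp, hn, hb⟩ := ih hrows
    match row, hT with
    | [], hT => exact absurd rfl (hT.ne_nil [] (by simp))
    | a :: row, hT =>
      have key : ∀ b ∈ l, a < b := by
        intro b hbl
        match rows, hT, hrows, hb, hn with
        | [], _, _, _, hn => rw [List.eq_nil_of_length_eq_zero hn] at hbl; simp at hbl
        | [] :: _, _, hrows, _, _ => exact absurd rfl (hrows.ne_nil [] (by simp))
        | (c :: cs) :: rs, hT, _, hb, _ =>
          exact ((List.isChain_cons_cons.1 hT.isChain).1.1).trans_le (hb c cs rs rfl b hbl)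
      refine ⟨l ++ [a], hl.append (by simp), ?_, by simp [hn], ?_⟩
      · simp only [List.pairwise_append]
        exact ⟨hp, by simp, fun b hb c hc => by simp at hc; subst hc; exact key b hb⟩
      · rintro a' row' rows' h b hbm
        simp only [List.cons.injEq] at h
        obtain ⟨⟨rfl, _⟩, _⟩ := h
        rcases List.mem_append.1 hbm with hbm | hbm
        · exact (key b hbm).le
        · simp at hbm; exact hbm.ge

/-! ### Increasing subwords and the length of the first row -/

theorem countP_le_rowInsert (x y : α) (row : List α) :
    row.countP (· ≤ y) ≤ (rowInsert x row).1.countP (· ≤ y) := by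
  induction row with
  | nil => simp
  | cons z zs ih =>
    by_cases hxz : x < z
    · simp only [rowInsert, hxz, if_true, List.countP_cons]
      split_ifs <;> grind
    · simp only [rowInsert, hxz, if_false, List.countP_cons]
      omega

/-- Only an entry larger than x can be bumped, so the entries below x survive and x joins them. -/
theorem countP_lt_add_one_le_rowInsert (x : α) (row : List α) :
    row.countP (· < x) + 1 ≤ (rowInsert x row).1.countP (· ≤ x) := by
  induction row with
  | nil => simp [rowInsert]
  | cons z zs ih =>
    by_cases hxz : x < z
    · have : zs.countP (· < x) ≤ zs.countP (· ≤ x) :=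
        List.countP_mono_left fun a _ => by simpa using le_of_lt
      simp only [rowInsert, hxz, if_true, List.countP_cons, decide_eq_true_eq, le_refl,
        not_lt.2 hxz.le, if_false]
      omega
    · simp only [rowInsert, hxz, if_false, List.countP_cons, decide_eq_true_eq]
      split_ifs <;> grind

theorem headD_foldl (w : List α) (x : α) :
    ((w ++ [x]).foldl tableauInsert []).headD [] =
      (rowInsert x ((w.foldl tableauInsert []).headD [])).1 := by
  obtain ⟨rows, h⟩ := tableauInsert_ne_nil (w.foldl tableauInsert []) x
  simp [h]

theorem length_le_countP {w l : List α} (hl : l.Sublist w) (hp : l.Pairwise (· < ·)) (y : α)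
    (hy : ∀ a ∈ l, a ≤ y) : l.length ≤ ((w.foldl tableauInsert []).headD []).countP (· ≤ y) := by
  induction w using List.reverseRecOn generalizing l y with
  | nil => simp_all
  | append_singleton w x ih =>
    rw [headD_foldl]
    obtain ⟨l₁, l₂, rfl, h₁, h₂⟩ := List.sublist_append_iff.1 hl
    have hp' := List.pairwise_append.1 hp
    have hcase : l₂ = [] ∨ l₂ = [x] := by
      have := List.mem_sublists.2 h₂
      simpa [List.sublists] using this
    rcases hcase with rfl | rfl
    · exact (ih (by simpa using h₁) hp y hy).trans (countP_le_rowInsert _ _ _)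
    · have hxy : x ≤ y := hy x (by simp)
      have h1 := countP_lt_add_one_le_rowInsert x ((w.foldl tableauInsert []).headD [])
      have h2 : (rowInsert x ((w.foldl tableauInsert []).headD [])).1.countP (· ≤ x) ≤
          (rowInsert x ((w.foldl tableauInsert []).headD [])).1.countP (· ≤ y) :=
        List.countP_mono_left fun a _ => by simpa using fun h => le_trans h hxy
      -- The induction hypothesis is applied to the chain without x, with its own last letter z < x
      -- as threshold.
      have h3 : l₁.length ≤ ((w.foldl tableauInsert []).headD []).countP (· < x) := by
        rcases List.eq_nil_or_concat l₁ with rfl | ⟨l', z, rfl⟩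
        · simp
        · have hz : z < x := hp'.2.2 z (by simp) x (by simp)
          refine (ih h₁ hp'.1 z fun a ha => ?_).trans
            (List.countP_mono_left fun a _ => by simpa using fun h => lt_of_le_of_lt h hz)
          rcases List.mem_append.1 (List.concat_eq_append ▸ ha) with ha | ha
          · have := (List.pairwise_append.1 (List.concat_eq_append ▸ hp'.1)).2.2 a ha z (by simp)
            exact this.le
          · simp at ha; exact ha.le
      simp only [List.length_append, List.length_singleton]
      omega

theorem length_le_headD {w l : List α} (hl : l.Sublist w) (hp : l.Pairwise (· < ·)) :
    l.length ≤ ((w.foldl tableauInsert []).headD []).length := by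
  rcases List.eq_nil_or_concat l with rfl | ⟨l', z, rfl⟩
  · simp
  · refine (length_le_countP hl hp z fun a ha => ?_).trans List.countP_le_length
    rcases List.mem_append.1 (List.concat_eq_append ▸ ha) with ha | ha
    · exact ((List.pairwise_append.1 (List.concat_eq_append ▸ hp)).2.2 a ha z (by simp)).le
    · simp at ha; exact ha.le

/-- The first row is a suffix of the reading word; chain equivalence pulls it back to `w`. -/
theorem exists_sublist_length_eq_headD (w : List α) :
    ∃ l : List α, l.Sublist w ∧ l.Pairwise (· ≤ ·) ∧
      l.length = ((w.foldl tableauInsert []).headD []).length := by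
  have hT := isTableau_foldl w
  have hc := (chainEquiv_foldl w).1.2
  cases h : w.foldl tableauInsert [] with
  | nil => exact ⟨[], by simp⟩
  | cons row rows =>
    rw [h] at hT hc
    obtain ⟨l, hl, hp, hn, -⟩ := hc row (List.sublist_append_right _ _)
      (hT.pairwise row (by simp))
    exact ⟨l, hl, hp, by simpa using hn⟩

theorem length_le_length_foldl {w l : List α} (hl : l.Sublist w) (hp : l.Pairwise (· > ·)) :
    l.length ≤ (w.foldl tableauInsert []).length := by
  obtain ⟨l', hl', hp', hn, -⟩ := (chainEquiv_foldl w).2.1 l hl hp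
  exact hn ▸ length_le_of_sublist_readingWord (isTableau_foldl w) hl' hp'

theorem exists_sublist_length_eq_foldl (w : List α) :
    ∃ l : List α, l.Sublist w ∧ l.Pairwise (· > ·) ∧
      l.length = (w.foldl tableauInsert []).length := by
  obtain ⟨l, hl, hp, hn, -⟩ := exists_sublist_readingWord (isTableau_foldl w)
  obtain ⟨l', hl', hp', hn', -⟩ := (chainEquiv_foldl w).2.2 l hl hp
  exact ⟨l', hl', hp', hn'.trans hn⟩

theorem length_rowInsert (x : α) (row : List α) :
    (rowInsert x row).1.length + (rowInsert x row).2.toList.length = row.length + 1 := by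
  induction row with
  | nil => simp [rowInsert]
  | cons y ys ih =>
    by_cases hxy : x < y <;> simp only [rowInsert, hxy, if_true, if_false, List.length_cons,
      Option.toList_some, List.length_nil] <;> omega

theorem sum_length_tableauInsert (T : List (List α)) (x : α) :
    ((tableauInsert T x).map List.length).sum = (T.map List.length).sum + 1 := by
  induction T generalizing x with
  | nil => simp [tableauInsert]
  | cons row rows ih =>
    have h := length_rowInsert x row
    cases hb : (rowInsert x row).2 with
    | none =>
      simp only [hb, Option.toList_none, List.length_nil] at h
      simp only [tableauInsert, hb, List.map_cons, List.sum_cons]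
      omega
    | some b =>
      simp only [hb, Option.toList_some, List.length_cons, List.length_nil] at h
      simp only [tableauInsert, hb, List.map_cons, List.sum_cons, ih]
      omega

theorem sum_length_foldl (w : List α) :
    ((w.foldl tableauInsert []).map List.length).sum = w.length := by
  induction w using List.reverseRecOn with
  | nil => simp
  | append_singleton w x ih => simp [sum_length_tableauInsert, ih]

end Words

/-! ### Shapes with at most two columns -/

section Shape

variable {n : ℕ}

/-- `σ` is decreasing on the set `S` of positions. -/
def DecreasingOn (σ : Equiv.Perm (Fin n)) (S : Finset (Fin n)) : Prop :=
  ∀ a ∈ S, ∀ b ∈ S, a < b → σ b < σ a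

/-- `σ` has no increasing subsequence of length three. -/
def Avoids123 (σ : Equiv.Perm (Fin n)) : Prop :=
  ∀ i j k : Fin n, i < j → j < k → σ i < σ j → σ j < σ k → False

theorem DecreasingOn.card_le {σ : Equiv.Perm (Fin n)} {S : Finset (Fin n)}
    (h : DecreasingOn σ S) : S.card ≤ (shape σ).length := by
  have hl : (((List.finRange n).filter (· ∈ S)).map σ).Sublist (List.ofFn σ) := by
    rw [List.ofFn_eq_map]
    exact List.filter_sublist.map σ
  have hp : (((List.finRange n).filter (· ∈ S)).map σ).Pairwise (· > ·) := by
    rw [List.pairwise_map, List.pairwise_filter]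
    refine (List.pairwise_lt_finRange n).imp fun {a b} hab ha hb => ?_
    exact h a (by simpa using ha) b (by simpa using hb) hab
  have hc : ((List.finRange n).filter (· ∈ S)).length = S.card := by
    rw [← List.toFinset_card_of_nodup ((List.nodup_finRange n).filter _)]
    congr 1
    ext
    simp
  simpa [shape, insertionTableau, hc] using length_le_length_foldl hl hp

theorem exists_finRange_sublist {σ : Equiv.Perm (Fin n)} {l : List (Fin n)}
    (hl : l.Sublist (List.ofFn σ)) : ∃ l' : List (Fin n), l'.Pairwise (· < ·) ∧ l = l'.map σ := by
  rw [List.ofFn_eq_map, List.sublist_map_iff] at hl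
  obtain ⟨l', hl', rfl⟩ := hl
  exact ⟨l', (List.pairwise_lt_finRange n).sublist hl', rfl⟩

theorem exists_decreasingOn (σ : Equiv.Perm (Fin n)) :
    ∃ S, DecreasingOn σ S ∧ S.card = (shape σ).length := by
  obtain ⟨l, hl, hp, hn⟩ := exists_sublist_length_eq_foldl (List.ofFn σ)
  obtain ⟨l, hlt, rfl⟩ := exists_finRange_sublist hl
  rw [List.pairwise_map] at hp
  refine ⟨l.toFinset, ?_, ?_⟩
  · intro a ha b hb hab
    rw [List.mem_toFinset] at ha hb
    have h₁ : l.Pairwise fun a b => a < b → σ b < σ a := by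
      refine hp.imp ?_
      exact fun h _ => h
    -- The positions in `l` increase, so the condition in the reversed order is vacuous.
    have h₂ : l.Pairwise (flip fun a b => a < b → σ b < σ a) :=
      hlt.imp fun {a b} h h' => absurd h' h.not_gt
    exact h₁.forall_of_forall_of_flip (fun x _ h => absurd h (lt_irrefl x)) h₂ ha hb hab
  · rw [List.toFinset_card_of_nodup (hlt.imp fun h => ne_of_lt h)]
    simpa [shape, insertionTableau] using hn

theorem headD_shape (σ : Equiv.Perm (Fin n)) :
    (shape σ).headD 0 = (((List.ofFn σ).foldl tableauInsert []).headD []).length := by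
  rw [shape, insertionTableau]
  cases (List.ofFn σ).foldl tableauInsert [] <;> simp

theorem avoids123_of_headD_le {σ : Equiv.Perm (Fin n)} (h : (shape σ).headD 0 ≤ 2) :
    Avoids123 σ := by
  intro i j k hij hjk h₁ h₂
  have hs : [i, j, k].Sublist (List.finRange n) :=
    List.sublist_of_subperm_of_pairwise (r := (· < ·))
      (List.subperm_of_subset (by simp [hij.ne, hjk.ne, (hij.trans hjk).ne]) (by simp))
      (by simp [hij, hjk, hij.trans hjk]) (List.pairwise_lt_finRange n)
  have hl : [σ i, σ j, σ k].Sublist (List.ofFn σ) := by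
    rw [List.ofFn_eq_map]
    exact hs.map σ
  have := length_le_headD hl (by simp [h₁, h₂, h₁.trans h₂])
  rw [← headD_shape, List.length_cons, List.length_cons, List.length_singleton] at this
  omega

theorem Avoids123.headD_le {σ : Equiv.Perm (Fin n)} (h : Avoids123 σ) :
    (shape σ).headD 0 ≤ 2 := by
  rw [headD_shape]
  obtain ⟨l, hl, hp, hn⟩ := exists_sublist_length_eq_headD (List.ofFn σ)
  obtain ⟨l, hlt, rfl⟩ := exists_finRange_sublist hl
  rw [← hn, List.length_map]
  by_contra hlen
  rw [List.pairwise_map] at hp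
  match l, hlen, hlt, hp with
  | [], h, _, _ => simp at h
  | [_], h, _, _ => simp at h
  | [_, _], h, _, _ => simp at h
  | i :: j :: k :: l, _, hlt, hp =>
    simp only [List.pairwise_cons, List.mem_cons, forall_eq_or_imp] at hlt hp
    have hij := hlt.1.1
    have hjk := hlt.2.1.1
    exact h i j k hij hjk (hp.1.1.lt_of_ne (σ.injective.ne hij.ne))
      (hp.2.1.1.lt_of_ne (σ.injective.ne hjk.ne))

theorem sum_shape (σ : Equiv.Perm (Fin n)) : (shape σ).sum = n := by
  simpa [shape, insertionTableau] using sum_length_foldl (List.ofFn σ)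

theorem shape_pairwise (σ : Equiv.Perm (Fin n)) : (shape σ).Pairwise (· ≥ ·) := by
  rw [← List.isChain_iff_pairwise, shape, List.isChain_map]
  exact (isTableau_foldl (List.ofFn σ)).isChain.imp fun a b h => h.length_le

theorem shape_pos (σ : Equiv.Perm (Fin n)) : ∀ x ∈ shape σ, 0 < x := by
  intro x hx
  obtain ⟨row, hrow, rfl⟩ := List.mem_map.1 hx
  exact List.length_pos_iff.2 ((isTableau_foldl (List.ofFn σ)).ne_nil row hrow)

/-- With parts 1 and 2 only, the sum exceeds the length exactly by the number of 2s, so length and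
sum determine the partition. -/
theorem eq_of_sum_eq_of_le_two {L₁ L₂ : List ℕ} (h₁ : L₁.Pairwise (· ≥ ·))
    (h₂ : L₂.Pairwise (· ≥ ·)) (p₁ : ∀ x ∈ L₁, 0 < x) (p₂ : ∀ x ∈ L₂, 0 < x)
    (t₁ : L₁.headD 0 ≤ 2) (t₂ : L₂.headD 0 ≤ 2) (hl : L₁.length = L₂.length)
    (hs : L₁.sum = L₂.sum) : L₁ = L₂ := by
  induction L₁ generalizing L₂ with
  | nil => exact (List.eq_nil_of_length_eq_zero hl.symm).symm
  | cons a A ih =>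
    match L₂, h₂, p₂, t₂, hl, hs with
    | b :: B, h₂, p₂, t₂, hl, hs =>
      have hsum : ∀ (c : ℕ) (C : List ℕ), (∀ x ∈ C, 0 < x) → (∀ x ∈ C, x ≤ c) →
          C.length ≤ C.sum ∧ C.sum ≤ C.length * c := by
        intro c C h h'
        refine ⟨?_, List.sum_le_card_nsmul C c h'⟩
        simpa using List.card_nsmul_le_sum C 1 h
      rw [List.pairwise_cons] at h₁ h₂
      have hA := hsum a A (fun x hx => p₁ x (by simp [hx])) h₁.1
      have hB := hsum b B (fun x hx => p₂ x (by simp [hx])) h₂.1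
      have ha := p₁ a (by simp)
      have hb := p₂ b (by simp)
      simp only [List.headD_cons, List.length_cons, List.sum_cons] at t₁ t₂ hl hs
      have hab : a = b := by
        interval_cases a <;> interval_cases b <;> omega
      subst hab
      rw [ih h₁.2 h₂.2 (fun x hx => p₁ x (by simp [hx])) (fun x hx => p₂ x (by simp [hx])) ?_ ?_
        (by omega) (by omega)]
      · cases A with
        | nil => simp
        | cons c C => exact (h₁.1 c (by simp)).trans t₁
      · cases B with
        | nil => simp
        | cons c C => exact (h₂.1 c (by simp)).trans t₂

theorem shape_eq_of_avoids123 {σ τ : Equiv.Perm (Fin n)} (hσ : Avoids123 σ) (hτ : Avoids123 τ)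
    (h : (shape σ).length = (shape τ).length) : shape σ = shape τ :=
  eq_of_sum_eq_of_le_two (shape_pairwise σ) (shape_pairwise τ) (shape_pos σ) (shape_pos τ)
    hσ.headD_le hτ.headD_le h ((sum_shape σ).trans (sum_shape τ).symm)

/-! ### Noninversions and left-to-right minima -/

/-- The number of pairs of positions which do not form an inversion. -/
def coinv (σ : Equiv.Perm (Fin n)) : ℕ :=
  (Finset.univ.filter fun p : Fin n × Fin n => p.1 < p.2 ∧ σ p.1 < σ p.2).card

theorem inv_add_coinv (σ : Equiv.Perm (Fin n)) :
    inv σ + coinv σ = (Finset.univ.filter fun p : Fin n × Fin n => p.1 < p.2).card := by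
  rw [inv, coinv, ← Finset.card_union_of_disjoint]
  · congr 1
    ext ⟨p, q⟩
    simp only [Finset.mem_union, Finset.mem_filter, Finset.mem_univ, true_and]
    constructor
    · rintro (h | h) <;> exact h.1
    · intro h
      rcases lt_or_gt_of_ne (σ.injective.ne h.ne) with h' | h'
      exacts [.inr ⟨h, h'⟩, .inl ⟨h, h'⟩]
  · rw [Finset.disjoint_filter]
    exact fun _ _ h h' => h.2.not_gt h'.2

/-- The positions of the left-to-right minima. -/
def leftMinima (σ : Equiv.Perm (Fin n)) : Finset (Fin n) :=
  Finset.univ.filter fun p => ∀ q < p, σ p < σ q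

theorem mem_leftMinima {σ : Equiv.Perm (Fin n)} {p : Fin n} :
    p ∈ leftMinima σ ↔ ∀ q < p, σ p < σ q := by
  simp [leftMinima]

theorem notMem_leftMinima {σ : Equiv.Perm (Fin n)} {p : Fin n} :
    p ∉ leftMinima σ ↔ ∃ q < p, σ q < σ p := by
  rw [mem_leftMinima]
  push Not
  exact exists_congr fun q => and_congr_right fun h =>
    ⟨fun h' => h'.lt_of_ne (σ.injective.ne h.ne), le_of_lt⟩

theorem decreasingOn_leftMinima (σ : Equiv.Perm (Fin n)) : DecreasingOn σ (leftMinima σ) :=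
  fun a _ _ hb hab => mem_leftMinima.1 hb a hab

theorem Avoids123.mem_leftMinima {σ : Equiv.Perm (Fin n)} (h : Avoids123 σ) {p q : Fin n}
    (hpq : p < q) (hσ : σ p < σ q) : p ∈ leftMinima σ := by
  by_contra hp
  obtain ⟨o, ho, ho'⟩ := notMem_leftMinima.1 hp
  exact h o p q ho hpq ho' hσ

theorem Avoids123.decreasingOn_compl {σ : Equiv.Perm (Fin n)} (h : Avoids123 σ) :
    DecreasingOn σ (leftMinima σ)ᶜ := by
  intro a ha b _ hab
  by_contra hlt
  exact Finset.mem_compl.1 ha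
    (h.mem_leftMinima hab ((not_lt.1 hlt).lt_of_ne (σ.injective.ne hab.ne)))

/-- A noninversion goes from a left-to-right minimum to a non-minimum, and its two ends cannot both
lie in S. -/
theorem Avoids123.coinv_le {σ : Equiv.Perm (Fin n)} (h : Avoids123 σ) {S : Finset (Fin n)}
    (hS : DecreasingOn σ S) :
    coinv σ ≤ (leftMinima σ \ S).card * ((leftMinima σ)ᶜ \ S).card +
      (leftMinima σ \ S).card * ((leftMinima σ)ᶜ ∩ S).card +
      (leftMinima σ ∩ S).card * ((leftMinima σ)ᶜ \ S).card := by
  simp only [← Finset.card_product]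
  refine le_trans (Finset.card_le_card ?_)
    ((Finset.card_union_le _ _).trans (Nat.add_le_add_right (Finset.card_union_le _ _) _))
  rintro ⟨p, q⟩ hpq
  simp only [Finset.mem_filter, Finset.mem_univ, true_and] at hpq
  have hp := h.mem_leftMinima hpq.1 hpq.2
  have hq := notMem_leftMinima.2 ⟨p, hpq⟩
  have : ¬ (p ∈ S ∧ q ∈ S) := fun h => (hS p h.1 q h.2 hpq.1).not_gt hpq.2
  simp only [Finset.mem_union, Finset.mem_product, Finset.mem_sdiff, Finset.mem_inter,
    Finset.mem_compl]
  tauto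

/-- With B the left-to-right minima, T the other positions and S a longest decreasing set: i = |B ∖
S|, j = |T ∖ S|, b = |B ∩ S|, t = |T ∩ S|. The inequalities i ≤ t and j ≤ b express |B| ≤ |S| and
|T| ≤ |S|. -/
theorem two_antichain_arith {i j b t r s e : ℕ} (he : e ≤ i * j + i * t + b * j) (hit : i ≤ t)
    (hjb : j ≤ b) (hs : b + t = s) (hr : i + j = r) :
    e ≤ r * s ∧ ∀ Δ < r, e + Δ = r * s →
      (b + i = s ∧ t + j = r) ∨ (b + i = r ∧ t + j = s) := by
  obtain ⟨u, rfl⟩ := Nat.exists_eq_add_of_le hit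
  obtain ⟨v, rfl⟩ := Nat.exists_eq_add_of_le hjb
  subst hs hr
  refine ⟨by nlinarith, fun Δ hΔ h => ?_⟩
  -- With t = i + u and b = j + v, the left side is exactly r * s minus the bound on e.
  have key : i * j + i * v + j * u ≤ Δ := by nlinarith
  rcases Nat.eq_zero_or_pos i with rfl | hi
  · have : u = 0 := by
      by_contra hu
      have : j * 1 ≤ j * u := Nat.mul_le_mul_left j (Nat.pos_of_ne_zero hu)
      omega
    omega
  rcases Nat.eq_zero_or_pos j with rfl | hj
  · have : v = 0 := by
      by_contra hu
      have : i * 1 ≤ i * v := Nat.mul_le_mul_left i (Nat.pos_of_ne_zero hu)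
      omega
    omega
  -- For i, j > 0 the term i * j already reaches r − 1 ≥ Δ, which leaves no room for u or v; then r
  -- = s.
  have hij : i + j ≤ i * j + 1 := by nlinarith
  have hv : v ≤ i * v := Nat.le_mul_of_pos_left v hi
  have hu : u ≤ j * u := Nat.le_mul_of_pos_left u hj
  have hu0 : u = 0 := by omega
  have hv0 : v = 0 := by omega
  omega

theorem Avoids123.coinv_bounds {σ : Equiv.Perm (Fin n)} (h : Avoids123 σ) {r s : ℕ}
    (hn : n = r + s) (hs : (shape σ).length = s) :
    coinv σ ≤ r * s ∧ ∀ Δ < r, coinv σ + Δ = r * s →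
      ((leftMinima σ).card = s ∧ (leftMinima σ)ᶜ.card = r) ∨
        ((leftMinima σ).card = r ∧ (leftMinima σ)ᶜ.card = s) := by
  obtain ⟨S, hS, hSc⟩ := exists_decreasingOn σ
  have hB := (decreasingOn_leftMinima σ).card_le
  have hT := h.decreasingOn_compl.card_le
  have h1 := Finset.card_inter_add_card_sdiff (leftMinima σ) S
  have h2 := Finset.card_inter_add_card_sdiff (leftMinima σ)ᶜ S
  have h3 := Finset.card_inter_add_card_sdiff S (leftMinima σ)
  have h4 : S \ leftMinima σ = (leftMinima σ)ᶜ ∩ S := by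
    ext; simp [and_comm]
  rw [h4, Finset.inter_comm] at h3
  have h5 := Finset.card_add_card_compl (leftMinima σ)
  rw [Fintype.card_fin] at h5
  rw [← h1, ← h2]
  refine two_antichain_arith (h.coinv_le hS) ?_ ?_ ?_ ?_ <;> omega

end Shape

/-! ### The products w_μ as explicit permutations -/

section Products

variable {n : ℕ}

theorem adjSwap_apply {a : ℕ} (h₁ : 1 ≤ a) (h₂ : a < n) (p : Fin n) :
    (adjSwap n a p : ℕ) = if (p : ℕ) + 1 = a then a else if (p : ℕ) = a then a - 1 else p := by
  rw [adjSwap, dif_pos ⟨h₁, h₂⟩, Equiv.swap_apply_def]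
  simp only [Fin.ext_iff]
  split_ifs <;> first | omega | rfl

theorem adjSwap_inv (a : ℕ) : (adjSwap n a)⁻¹ = adjSwap n a := by
  rw [adjSwap]
  split_ifs
  · exact Equiv.swap_inv _ _
  · exact inv_one

/-- The rightmost swap acts first: the one-based position a + m is carried down through all swaps to
a, and each position from a to a + m − 1 moves up by one. -/
theorem prod_adjSwap_apply {a m : ℕ} (h₁ : 1 ≤ a) (h₂ : a + m ≤ n) (p : Fin n) :
    ((((List.range m).map fun j => adjSwap n (a + j)).prod p : Fin n) : ℕ) =
      if (p : ℕ) + 1 = a + m then a - 1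
      else if a ≤ (p : ℕ) + 1 ∧ (p : ℕ) + 1 < a + m then p + 1 else p := by
  induction m generalizing p with
  | zero =>
    simp only [List.range_zero, List.map_nil, List.prod_nil, Equiv.Perm.coe_one, id_eq]
    split_ifs <;> omega
  | succ m ih =>
    rw [List.range_succ, List.map_append, List.prod_append, Equiv.Perm.mul_apply, ih (by omega)]
    simp only [List.map_cons, List.map_nil, List.prod_singleton]
    rw [adjSwap_apply (by omega) (by omega)]
    split_ifs <;> omega

/-- The product of the first `m` cycles of `innerProd`. -/
def innerProdAux (n c : ℕ) (μ : YoungDiagram) (m : ℕ) : Equiv.Perm (Fin n) :=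
  ((List.range m).map fun i =>
    ((List.range (μ.rowLen i)).map fun j => adjSwap n (c - i + j)).prod).prod

theorem innerProdAux_succ (n c : ℕ) (μ : YoungDiagram) (m : ℕ) :
    innerProdAux n c μ (m + 1) = innerProdAux n c μ m *
      ((List.range (μ.rowLen m)).map fun j => adjSwap n (c - m + j)).prod := by
  simp [innerProdAux, List.range_succ]

/-- The cycle with index m, applied first, brings the m-th entry of the first block home. It fixes
the others: those with smaller index sit to the right of its support, those with larger index to the
left. -/
theorem innerProdAux_apply_bottom {c₁ c₂ : ℕ} (hc : c₁ + c₂ = n) {μ : YoungDiagram}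
    (hμ : μ.rowLen 0 ≤ c₂) {m : ℕ} (hm : m ≤ c₁) {i : ℕ} (hi : i < c₁) (p : Fin n)
    (hp : (p : ℕ) + i + 1 = c₁ + if i < m then μ.rowLen i else 0) :
    (innerProdAux n c₁ μ m p : ℕ) + i + 1 = c₁ := by
  induction m generalizing p with
  | zero => simpa [innerProdAux] using hp
  | succ m ih =>
    rw [innerProdAux_succ, Equiv.Perm.mul_apply]
    apply ih (by omega)
    have h0 := μ.rowLen_anti 0 m (Nat.zero_le m)
    rw [prod_adjSwap_apply (by omega) (by omega)]
    rcases lt_trichotomy i m with h | rfl | h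
    · have := μ.rowLen_anti i m h.le
      simp only [h, h.trans (Nat.lt_succ_self m), if_true] at hp ⊢
      split_ifs <;> omega
    · simp only [Nat.lt_succ_self, lt_irrefl, if_true, if_false] at hp ⊢
      split_ifs <;> omega
    · have h' : ¬ i < m + 1 := by omega
      simp only [h', h.not_gt, if_false] at hp ⊢
      split_ifs <;> omega

/-- The cycle with index m moves the j-th entry of the second block up by one precisely when μ has
the cell (m, j), whence the column length. -/
theorem innerProdAux_apply_top {c₁ c₂ : ℕ} (hc : c₁ + c₂ = n) {μ : YoungDiagram}
    (hμ : μ.rowLen 0 ≤ c₂) {m : ℕ} (hm : m ≤ c₁) {j : ℕ} (p : Fin n)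
    (hp : (p : ℕ) + min m (μ.colLen j) = c₁ + j) :
    (innerProdAux n c₁ μ m p : ℕ) = c₁ + j := by
  induction m generalizing p with
  | zero => simpa [innerProdAux] using hp
  | succ m ih =>
    rw [innerProdAux_succ, Equiv.Perm.mul_apply]
    apply ih (by omega)
    have h0 := μ.rowLen_anti 0 m (Nat.zero_le m)
    rw [prod_adjSwap_apply (by omega) (by omega)]
    have hiff : m < μ.colLen j ↔ j < μ.rowLen m := by
      rw [← YoungDiagram.mem_iff_lt_colLen, YoungDiagram.mem_iff_lt_rowLen]
    split_ifs <;> omega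

theorem rowLen_eq_zero {μ : YoungDiagram} {i : ℕ} (h : μ.colLen 0 ≤ i) : μ.rowLen i = 0 := by
  by_contra h'
  have := YoungDiagram.mem_iff_lt_colLen.1
    (YoungDiagram.mem_iff_lt_rowLen.2 (Nat.pos_of_ne_zero h'))
  omega

theorem innerProd_apply_bottom {c₁ c₂ : ℕ} (hc : c₁ + c₂ = n) {μ : YoungDiagram}
    (hμ : μ.rowLen 0 ≤ c₂) (hμ' : μ.colLen 0 ≤ c₁) {i : ℕ} (hi : i < c₁) (p : Fin n)
    (hp : (p : ℕ) + i + 1 = c₁ + μ.rowLen i) : (innerProd n c₁ μ p : ℕ) + i + 1 = c₁ := by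
  refine innerProdAux_apply_bottom hc hμ hμ' hi p ?_
  split_ifs with h
  · exact hp
  · rw [hp, rowLen_eq_zero (not_lt.1 h)]

theorem innerProd_apply_top {c₁ c₂ : ℕ} (hc : c₁ + c₂ = n) {μ : YoungDiagram}
    (hμ : μ.rowLen 0 ≤ c₂) (hμ' : μ.colLen 0 ≤ c₁) {j : ℕ} (p : Fin n)
    (hp : (p : ℕ) + μ.colLen j = c₁ + j) : (innerProd n c₁ μ p : ℕ) = c₁ + j := by
  refine innerProdAux_apply_top hc hμ hμ' p ?_
  rwa [min_eq_right (μ.colLen_anti 0 j (Nat.zero_le j))]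

theorem outerProd_eq_inv (n c : ℕ) (ν : YoungDiagram) : outerProd n c ν = (innerProd n c ν)⁻¹ := by
  simp only [outerProd, innerProd, List.prod_inv_reverse, List.map_map, ← List.map_reverse,
    Function.comp_def, adjSwap_inv]

/-- π reverses the first block: the entry with index i from the right has a value with index k = c₁
− 1 − i from the top. So positions are governed by row i of μ and values by row k of ν. -/
theorem act_apply_bottom {c₁ c₂ : ℕ} {π : Equiv.Perm (Fin n)} (hπ : CorrespondsTo π c₁ c₂)
    {J : PartitionPair} (hJ : J.IsJumpPartition c₁ c₂) {i k : ℕ} (hik : i + k + 1 = c₁) (p : Fin n)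
    (hp : (p : ℕ) + i + 1 = c₁ + J.inner.rowLen i) :
    (J.act c₁ π p : ℕ) = i + J.outer.rowLen k := by
  obtain ⟨-, -, hc, hπ⟩ := hπ
  obtain ⟨⟨h₁, h₂⟩, h₃, h₄⟩ := hJ
  have h := innerProd_apply_bottom hc h₂.le h₁ (by omega) p hp
  have hq := (hπ (innerProd n c₁ J.inner p)).1 (by omega)
  have h0 := J.outer.rowLen_anti 0 k (Nat.zero_le k)
  have hx := innerProd_apply_bottom (i := k) hc h₄.le h₃ (by omega)
    ⟨i + J.outer.rowLen k, by omega⟩ (by simp only; omega)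
  rw [PartitionPair.act, outerProd_eq_inv, Equiv.Perm.mul_apply, Equiv.Perm.mul_apply]
  have : π (innerProd n c₁ J.inner p) =
      innerProd n c₁ J.outer ⟨i + J.outer.rowLen k, by omega⟩ := Fin.ext (by omega)
  rw [this, Equiv.Perm.inv_def, Equiv.symm_apply_apply]

theorem act_apply_top {c₁ c₂ : ℕ} {π : Equiv.Perm (Fin n)} (hπ : CorrespondsTo π c₁ c₂)
    {J : PartitionPair} (hJ : J.IsJumpPartition c₁ c₂) {j k : ℕ} (hjk : j + k + 1 = c₂) (p : Fin n)
    (hp : (p : ℕ) + J.inner.colLen j = c₁ + j) :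
    (J.act c₁ π p : ℕ) + J.outer.colLen k = c₁ + k := by
  obtain ⟨-, -, hc, hπ⟩ := hπ
  obtain ⟨⟨h₁, h₂⟩, h₃, h₄⟩ := hJ
  have h := innerProd_apply_top hc h₂.le h₁ p hp
  have hq := (hπ (innerProd n c₁ J.inner p)).2 (by omega)
  have h0 := J.outer.colLen_anti 0 k (Nat.zero_le k)
  have hx := innerProd_apply_top (j := k) hc h₄.le h₃
    ⟨c₁ + k - J.outer.colLen k, by omega⟩ (by simp only; omega)
  rw [PartitionPair.act, outerProd_eq_inv, Equiv.Perm.mul_apply, Equiv.Perm.mul_apply]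
  have : π (innerProd n c₁ J.inner p) =
      innerProd n c₁ J.outer ⟨c₁ + k - J.outer.colLen k, by omega⟩ := Fin.ext (by omega)
  rw [this, Equiv.Perm.inv_def, Equiv.symm_apply_apply]
  simp only
  omega

/-- The image of p lies in one of the two blocks; the position predicted for that index has the same
image, so it is p by injectivity. -/
theorem exists_position {c₁ c₂ : ℕ} (hc : c₁ + c₂ = n) {μ : YoungDiagram}
    (hμ : μ.rowLen 0 ≤ c₂) (hμ' : μ.colLen 0 ≤ c₁) (p : Fin n) :
    (∃ i < c₁, (p : ℕ) + i + 1 = c₁ + μ.rowLen i) ∨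
      ∃ j < c₂, (p : ℕ) + μ.colLen j = c₁ + j := by
  rcases lt_or_ge (innerProd n c₁ μ p : ℕ) c₁ with h | h
  · left
    refine ⟨c₁ - 1 - innerProd n c₁ μ p, by omega, ?_⟩
    set i := c₁ - 1 - (innerProd n c₁ μ p : ℕ) with hi
    have h0 := μ.rowLen_anti 0 i (Nat.zero_le i)
    have hx := innerProd_apply_bottom (i := i) hc hμ hμ' (by omega)
      ⟨c₁ - 1 - i + μ.rowLen i, by omega⟩ (by simp only; omega)
    have : innerProd n c₁ μ p = innerProd n c₁ μ ⟨c₁ - 1 - i + μ.rowLen i, by omega⟩ :=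
      Fin.ext (by omega)
    have := congrArg Fin.val ((innerProd n c₁ μ).injective this)
    simp only at this
    omega
  · right
    have hlt := (innerProd n c₁ μ p).isLt
    refine ⟨innerProd n c₁ μ p - c₁, by omega, ?_⟩
    set j := (innerProd n c₁ μ p : ℕ) - c₁ with hj
    have h0 := μ.colLen_anti 0 j (Nat.zero_le j)
    have hx := innerProd_apply_top (j := j) hc hμ hμ'
      ⟨c₁ + j - μ.colLen j, by omega⟩ (by simp only; omega)
    have : innerProd n c₁ μ p = innerProd n c₁ μ ⟨c₁ + j - μ.colLen j, by omega⟩ :=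
      Fin.ext (by omega)
    have := congrArg Fin.val ((innerProd n c₁ μ).injective this)
    simp only at this
    omega

end Products

/-! ### The diagram of a pair of complementary sequences -/

section Cross

variable {n c₁ c₂ : ℕ}

/-- The diagram of the pairs `(i, j)` with `t j < b i`, for `b` decreasing and `t` increasing. -/
def crossDiagram (b : Fin c₁ → Fin n) (t : Fin c₂ → Fin n) (hb : StrictAnti b)
    (ht : StrictMono t) : YoungDiagram where
  cells := (Finset.univ.filter fun p : Fin c₁ × Fin c₂ => t p.2 < b p.1).map
    (Fin.valEmbedding.prodMap Fin.valEmbedding)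
  isLowerSet := by
    rintro ⟨i, j⟩ ⟨i', j'⟩ ⟨hi, hj⟩ h
    simp only [Finset.coe_map, Set.mem_image, Finset.mem_coe, Finset.mem_filter, Finset.mem_univ,
      true_and, Prod.exists, Function.Embedding.coe_prodMap, Prod.map_apply,
      Fin.valEmbedding_apply, Prod.mk.injEq] at h ⊢
    simp only at hi hj
    obtain ⟨k, l, hkl, rfl, rfl⟩ := h
    exact ⟨⟨i', by omega⟩, ⟨j', by omega⟩,
      (ht.monotone (Fin.le_def.2 hj)).trans_lt (hkl.trans_le (hb.antitone (Fin.le_def.2 hi))),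
      rfl, rfl⟩

variable {b : Fin c₁ → Fin n} {t : Fin c₂ → Fin n} (hb : StrictAnti b) (ht : StrictMono t)

theorem mem_crossDiagram {i j : ℕ} : (i, j) ∈ crossDiagram b t hb ht ↔
    ∃ (hi : i < c₁) (hj : j < c₂), t ⟨j, hj⟩ < b ⟨i, hi⟩ := by
  rw [← YoungDiagram.mem_cells]
  simp only [crossDiagram, Finset.mem_map, Finset.mem_filter, Finset.mem_univ,
      true_and, Prod.exists, Function.Embedding.coe_prodMap, Prod.map_apply,
      Fin.valEmbedding_apply, Prod.mk.injEq]
  constructor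
  · rintro ⟨k, l, hkl, rfl, rfl⟩
    exact ⟨k.2, l.2, hkl⟩
  · rintro ⟨hi, hj, h⟩
    exact ⟨_, _, h, rfl, rfl⟩

theorem card_crossDiagram : (crossDiagram b t hb ht).card =
    (Finset.univ.filter fun p : Fin c₁ × Fin c₂ => t p.2 < b p.1).card :=
  Finset.card_map _

theorem card_filter_val_eq {c m : ℕ} (P : Fin c → Prop) [DecidablePred P] (hm : m ≤ c)
    (h : ∀ i : Fin c, P i ↔ (i : ℕ) < m) : (Finset.univ.filter P).card = m := by
  rw [← Finset.card_map Fin.valEmbedding]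
  have : (Finset.univ.filter P).map Fin.valEmbedding = Finset.range m := by
    ext x
    simp only [Finset.mem_map, Finset.mem_filter, Finset.mem_univ, true_and,
      Fin.valEmbedding_apply, Finset.mem_range]
    constructor
    · rintro ⟨i, hi, rfl⟩
      exact (h i).1 hi
    · intro hx
      exact ⟨⟨x, by omega⟩, (h _).2 hx, rfl⟩
  rw [this, Finset.card_range]

theorem rowLen_crossDiagram_le (i : ℕ) : (crossDiagram b t hb ht).rowLen i ≤ c₂ := by
  by_contra h
  obtain ⟨-, hj, -⟩ := (mem_crossDiagram hb ht).1 (YoungDiagram.mem_iff_lt_rowLen.2 (not_le.1 h))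
  omega

theorem colLen_crossDiagram_le (j : ℕ) : (crossDiagram b t hb ht).colLen j ≤ c₁ := by
  by_contra h
  obtain ⟨hi, -, -⟩ := (mem_crossDiagram hb ht).1 (YoungDiagram.mem_iff_lt_colLen.2 (not_le.1 h))
  omega

variable (hbt : ∀ p, (∃ i, b i = p) ∨ ∃ j, t j = p) (hne : ∀ i j, b i ≠ t j)

include hb ht hbt hne in
theorem val_eq_card_add_card (p : Fin n) : (p : ℕ) =
    (Finset.univ.filter fun i => b i < p).card + (Finset.univ.filter fun j => t j < p).card := by
  rw [← Finset.card_image_of_injective _ hb.injective,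
    ← Finset.card_image_of_injective (Finset.univ.filter fun j => t j < p) ht.injective,
    ← Finset.card_union_of_disjoint, ← Fin.card_Iio p]
  · congr 1
    ext q
    simp only [Finset.mem_Iio, Finset.mem_union, Finset.mem_image, Finset.mem_filter,
      Finset.mem_univ, true_and]
    constructor
    · intro h
      rcases hbt q with ⟨i, rfl⟩ | ⟨j, rfl⟩
      exacts [.inl ⟨i, h, rfl⟩, .inr ⟨j, h, rfl⟩]
    · rintro (⟨i, h, rfl⟩ | ⟨j, h, rfl⟩) <;> exact h
  · rw [Finset.disjoint_left]
    simp only [Finset.mem_image, Finset.mem_filter, Finset.mem_univ, true_and]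
    rintro _ ⟨i, _, rfl⟩ ⟨j, _, h⟩
    exact hne i j h.symm

-- To the left of `b i` lie the c₁ − 1 − i later terms of `b` and the terms of `t` counted by row i.
include hbt hne in
theorem val_bottom_eq (i : Fin c₁) :
    (b i : ℕ) + i + 1 = c₁ + (crossDiagram b t hb ht).rowLen i := by
  have h := val_eq_card_add_card hb ht hbt hne (b i)
  rw [card_filter_val_eq (fun j => t j < b i) (rowLen_crossDiagram_le hb ht i)] at h
  · have h' := Finset.card_filter_add_card_filter_not (s := (Finset.univ : Finset (Fin c₁)))
      (fun k => b k < b i)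
    rw [card_filter_val_eq (fun k => ¬ b k < b i) (m := i + 1) (by omega), Finset.card_univ,
      Fintype.card_fin] at h'
    · omega
    · intro k
      rw [hb.lt_iff_gt, not_lt, Fin.le_def]
      omega
  · intro j
    rw [← YoungDiagram.mem_iff_lt_rowLen, mem_crossDiagram]
    simp

-- To the left of `t j` lie j terms of `t` and all terms of `b` except those counted by column j.
include hbt hne in
theorem val_top_eq (j : Fin c₂) :
    (t j : ℕ) + (crossDiagram b t hb ht).colLen j = c₁ + j := by
  have h := val_eq_card_add_card hb ht hbt hne (t j)
  rw [card_filter_val_eq (fun k => t k < t j) (m := j) (by omega)] at h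
  · have h' := Finset.card_filter_add_card_filter_not (s := (Finset.univ : Finset (Fin c₁)))
      (fun k => b k < t j)
    rw [card_filter_val_eq (fun k => ¬ b k < t j) (colLen_crossDiagram_le hb ht j),
      Finset.card_univ, Fintype.card_fin] at h'
    · omega
    · intro k
      rw [← YoungDiagram.mem_iff_lt_colLen, mem_crossDiagram, not_lt]
      have := hne k j
      simp only [Fin.eta, Fin.is_lt, exists_true_left]
      exact ⟨fun h => h.lt_of_ne this.symm, le_of_lt⟩
  · intro k
    rw [ht.lt_iff_lt, Fin.lt_def]

end Cross

/-! ### The jump partition read off from bottoms and tops -/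

section Decomposition

variable {n c₁ c₂ : ℕ}

theorem rowLen_le_card (μ : YoungDiagram) (i : ℕ) : μ.rowLen i ≤ μ.card := by
  rw [YoungDiagram.rowLen_eq_card]
  exact Finset.card_le_card (Finset.filter_subset _ _)

/-- The bottoms `b i`, read from right to left, and the tops `t j`, read from left to right, of a
permutation which is a union of two decreasing sequences. -/
structure IsSplit (σ : Equiv.Perm (Fin n)) (b : Fin c₁ → Fin n) (t : Fin c₂ → Fin n) : Prop where
  anti : StrictAnti b
  mono : StrictMono t
  mono_val : StrictMono (σ ∘ b)
  anti_val : StrictAnti (σ ∘ t)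
  cover : ∀ p, (∃ i, b i = p) ∨ ∃ j, t j = p
  ne : ∀ i j, b i ≠ t j

theorem Avoids123.exists_isSplit {σ : Equiv.Perm (Fin n)} (h : Avoids123 σ)
    (h₁ : (leftMinima σ).card = c₁) (h₂ : (leftMinima σ)ᶜ.card = c₂) :
    ∃ (b : Fin c₁ → Fin n) (t : Fin c₂ → Fin n), IsSplit σ b t ∧
      ∀ p, p ∈ leftMinima σ ↔ ∃ i, b i = p := by
  have hB : ∀ p, p ∈ leftMinima σ ↔ ∃ i : Fin c₁, (leftMinima σ).orderEmbOfFin h₁ i.rev = p := by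
    intro p
    rw [← Finset.mem_coe, ← Finset.range_orderEmbOfFin _ h₁, Set.mem_range,
      ← Fin.revPerm.exists_congr_right]
    simp
  have hT : ∀ p, p ∈ (leftMinima σ)ᶜ ↔ ∃ i : Fin c₂, (leftMinima σ)ᶜ.orderEmbOfFin h₂ i = p := by
    intro p
    rw [← Finset.mem_coe, ← Finset.range_orderEmbOfFin _ h₂, Set.mem_range]
  have hanti : StrictAnti fun i : Fin c₁ => (leftMinima σ).orderEmbOfFin h₁ i.rev :=
    fun i j hij => (OrderEmbedding.strictMono _) (Fin.rev_lt_rev.2 hij)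
  refine ⟨fun i => (leftMinima σ).orderEmbOfFin h₁ i.rev, (leftMinima σ)ᶜ.orderEmbOfFin h₂,
    ⟨hanti, OrderEmbedding.strictMono _, ?_, ?_, ?_, ?_⟩, hB⟩
  · exact fun i j hij => decreasingOn_leftMinima σ _ (Finset.orderEmbOfFin_mem _ _ _) _
      (Finset.orderEmbOfFin_mem _ _ _) (hanti hij)
  · exact fun i j hij => h.decreasingOn_compl _ (Finset.orderEmbOfFin_mem _ _ _) _
      (Finset.orderEmbOfFin_mem _ _ _) (OrderEmbedding.strictMono _ hij)
  · intro p
    rw [← hB, ← hT, Finset.mem_compl]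
    exact em _
  · intro i j hij
    exact Finset.mem_compl.1 ((hT _).2 ⟨j, rfl⟩) ((hB _).2 ⟨i, hij⟩)

variable {σ : Equiv.Perm (Fin n)} {b : Fin c₁ → Fin n} {t : Fin c₂ → Fin n}

theorem IsSplit.anti_rev (h : IsSplit σ b t) : StrictAnti fun i : Fin c₁ => σ (b i.rev) :=
  fun _ _ hij => h.mono_val (Fin.rev_lt_rev.2 hij)

theorem IsSplit.mono_rev (h : IsSplit σ b t) : StrictMono fun j : Fin c₂ => σ (t j.rev) :=
  fun _ _ hij => h.anti_val (Fin.rev_lt_rev.2 hij)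

theorem IsSplit.cover_rev (h : IsSplit σ b t) (p : Fin n) :
    (∃ i : Fin c₁, σ (b i.rev) = p) ∨ ∃ j : Fin c₂, σ (t j.rev) = p := by
  rcases h.cover (σ.symm p) with ⟨i, hi⟩ | ⟨j, hj⟩
  · exact .inl ⟨i.rev, by simp [hi]⟩
  · exact .inr ⟨j.rev, by simp [hj]⟩

theorem IsSplit.ne_rev (h : IsSplit σ b t) (i : Fin c₁) (j : Fin c₂) :
    σ (b i.rev) ≠ σ (t j.rev) :=
  fun h' => h.ne _ _ (σ.injective h')

/-- The pair of partitions recording the relative positions and values of bottoms and tops. -/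
def IsSplit.jump (h : IsSplit σ b t) : PartitionPair where
  inner := crossDiagram b t h.anti h.mono
  outer := crossDiagram (fun i => σ (b i.rev)) (fun j => σ (t j.rev)) h.anti_rev h.mono_rev

/-- The diagrams of σ encode the positions and values of its bottoms and tops, and the action of J
reproduces exactly these. -/
theorem IsSplit.act_jump (h : IsSplit σ b t) {π : Equiv.Perm (Fin n)}
    (hπ : CorrespondsTo π c₁ c₂) (hJ : h.jump.IsJumpPartition c₁ c₂) : h.jump.act c₁ π = σ := by
  ext p
  rcases h.cover p with ⟨i, rfl⟩ | ⟨j, rfl⟩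
  · rw [act_apply_bottom hπ hJ (i := i) (k := i.rev) (by rw [Fin.val_rev]; omega) (b i)
      (val_bottom_eq h.anti h.mono h.cover h.ne i)]
    have := val_bottom_eq h.anti_rev h.mono_rev h.cover_rev h.ne_rev i.rev
    rw [Fin.rev_rev, Fin.val_rev] at this
    rw [Fin.val_rev]
    simp only [IsSplit.jump]
    omega
  · have h₁ := act_apply_top hπ hJ (j := j) (k := j.rev) (by rw [Fin.val_rev]; omega) (t j)
      (val_top_eq h.anti h.mono h.cover h.ne j)
    have h₂ := val_top_eq h.anti_rev h.mono_rev h.cover_rev h.ne_rev j.rev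
    rw [Fin.rev_rev] at h₂
    simp only [IsSplit.jump] at h₁ h₂ ⊢
    omega

theorem IsSplit.card_outer (h : IsSplit σ b t) : h.jump.outer.card =
    (Finset.univ.filter fun p : Fin c₁ × Fin c₂ => σ (t p.2) < σ (b p.1)).card := by
  rw [IsSplit.jump, card_crossDiagram]
  refine Finset.card_equiv (Fin.revPerm.prodCongr Fin.revPerm) fun p => ?_
  simp

theorem IsSplit.coinv_eq (h : IsSplit σ b t) (hB : ∀ i, b i ∈ leftMinima σ) :
    coinv σ =
    (Finset.univ.filter fun p : Fin c₁ × Fin c₂ => b p.1 < t p.2 ∧ σ (b p.1) < σ (t p.2)).card := by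
  rw [coinv, ← Finset.card_image_of_injective _ (h.anti.injective.prodMap h.mono.injective)]
  congr 1
  ext ⟨p, q⟩
  simp only [Finset.mem_image, Finset.mem_filter, Finset.mem_univ, true_and, Prod.exists,
    Prod.map_apply, Prod.mk.injEq]
  constructor
  · intro hpq
    rcases h.cover q with ⟨j, rfl⟩ | ⟨j, rfl⟩
    · exact absurd hpq.2 (mem_leftMinima.1 (hB j) p hpq.1).not_gt
    rcases h.cover p with ⟨i, rfl⟩ | ⟨i, rfl⟩
    · exact ⟨i, j, hpq, rfl, rfl⟩
    · exact absurd hpq.2 (h.anti_val (h.mono.lt_iff_lt.1 hpq.1)).not_gt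
  · rintro ⟨i, j, hij, rfl, rfl⟩
    exact hij

/-- Each pair (bottom, top) has the top to the left, or the top smaller, or is a noninversion. The
first two exclude each other because a bottom is smaller than everything to its left. -/
theorem IsSplit.size_jump_add_coinv (h : IsSplit σ b t) (hB : ∀ i, b i ∈ leftMinima σ) :
    h.jump.size + coinv σ = c₁ * c₂ := by
  rw [PartitionPair.size, h.card_outer, h.coinv_eq hB, IsSplit.jump, card_crossDiagram,
    ← Finset.card_union_of_disjoint, ← Finset.card_union_of_disjoint]
  · trans (Finset.univ : Finset (Fin c₁ × Fin c₂)).card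
    · congr 1
      ext ⟨i, j⟩
      simp only [Finset.mem_union, Finset.mem_filter, Finset.mem_univ, true_and, iff_true]
      rcases lt_or_gt_of_ne (h.ne i j) with h₁ | h₁
      · rcases lt_or_gt_of_ne (σ.injective.ne (h.ne i j)) with h₂ | h₂
        exacts [.inr ⟨h₁, h₂⟩, .inl (.inr h₂)]
      · exact .inl (.inl h₁)
    · simp
  · rw [Finset.disjoint_left]
    simp only [Finset.mem_union, Finset.mem_filter, Finset.mem_univ, true_and]
    rintro ⟨i, j⟩ (h₁ | h₁) ⟨h₂, h₃⟩
    exacts [h₁.not_gt h₂, h₁.not_gt h₃]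
  · rw [Finset.disjoint_filter]
    rintro ⟨i, j⟩ - h₁ h₂
    exact (mem_leftMinima.1 (hB i) _ h₁).not_gt h₂

end Decomposition

/-! ### Layered permutations -/

section Minimal

variable {n c₁ c₂ : ℕ} {π : Equiv.Perm (Fin n)}

theorem exists_correspondsTo (h₁ : 0 < c₁) (h₂ : 0 < c₂) (hn : c₁ + c₂ = n) :
    ∃ π : Equiv.Perm (Fin n), CorrespondsTo π c₁ c₂ := by
  let f : Fin n → Fin n := fun p =>
    if h : (p : ℕ) < c₁ then ⟨c₁ - 1 - p, by omega⟩ else ⟨c₁ + n - 1 - p, by omega⟩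
  have hf₁ : ∀ p : Fin n, (p : ℕ) < c₁ → (f p : ℕ) + p + 1 = c₁ := by
    intro p hp
    simp only [f, dif_pos hp]
    omega
  have hf₂ : ∀ p : Fin n, c₁ ≤ (p : ℕ) → (f p : ℕ) + p + 1 = c₁ + n := by
    intro p hp
    simp only [f, dif_neg hp.not_gt]
    omega
  have hf : Function.Involutive f := by
    intro p
    apply Fin.ext
    rcases lt_or_ge (p : ℕ) c₁ with hp | hp
    · have h₁ := hf₁ p hp
      have h₂ := hf₁ (f p) (by omega)
      omega
    · have h₁ := hf₂ p hp
      have h₂ := hf₂ (f p) (by omega)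
      omega
  exact ⟨hf.toPerm, h₁, h₂, hn, fun p => ⟨hf₁ p, hf₂ p⟩⟩

theorem CorrespondsTo.eq {π' : Equiv.Perm (Fin n)} (h : CorrespondsTo π c₁ c₂)
    (h' : CorrespondsTo π' c₁ c₂) : π = π' := by
  ext p
  rcases lt_or_ge (p : ℕ) c₁ with hp | hp
  · have h₁ := (h.2.2.2 p).1 hp
    have h₂ := (h'.2.2.2 p).1 hp
    omega
  · have h₁ := (h.2.2.2 p).2 hp
    have h₂ := (h'.2.2.2 p).2 hp
    omega

theorem CorrespondsTo.lt_and_lt_iff (h : CorrespondsTo π c₁ c₂) (p q : Fin n) :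
    (p < q ∧ π p < π q) ↔ (p : ℕ) < c₁ ∧ ¬ (q : ℕ) < c₁ := by
  obtain ⟨-, -, -, h⟩ := h
  have hp := h p
  have hq := h q
  simp only [Fin.lt_def]
  omega

theorem CorrespondsTo.avoids123 (h : CorrespondsTo π c₁ c₂) : Avoids123 π := by
  intro i j k hij hjk h₁ h₂
  have := (h.lt_and_lt_iff i j).1 ⟨hij, h₁⟩
  have := (h.lt_and_lt_iff j k).1 ⟨hjk, h₂⟩
  omega

theorem CorrespondsTo.card_bottoms (h : CorrespondsTo π c₁ c₂) :
    (Finset.univ.filter fun p : Fin n => (p : ℕ) < c₁).card = c₁ :=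
  card_filter_val_eq _ (by have := h.2.2.1; omega) fun _ => Iff.rfl

theorem CorrespondsTo.card_tops (h : CorrespondsTo π c₁ c₂) :
    (Finset.univ.filter fun p : Fin n => ¬ (p : ℕ) < c₁).card = c₂ := by
  have h' := Finset.card_filter_add_card_filter_not (s := (Finset.univ : Finset (Fin n)))
    (fun p => (p : ℕ) < c₁)
  rw [h.card_bottoms, Finset.card_univ, Fintype.card_fin] at h'
  have := h.2.2.1
  omega

theorem CorrespondsTo.coinv_eq (h : CorrespondsTo π c₁ c₂) : coinv π = c₁ * c₂ := by
  suffices hprod : (Finset.univ.filter fun p : Fin n × Fin n => p.1 < p.2 ∧ π p.1 < π p.2) =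
      (Finset.univ.filter fun p : Fin n => (p : ℕ) < c₁) ×ˢ
        (Finset.univ.filter fun p : Fin n => ¬ (p : ℕ) < c₁) by
    rw [coinv, hprod, Finset.card_product, h.card_bottoms, h.card_tops]
  ext ⟨p, q⟩
  simp only [Finset.mem_filter, Finset.mem_univ, true_and, Finset.mem_product]
  exact h.lt_and_lt_iff p q

/-- Each block is decreasing, while two entries from different blocks form a noninversion; so a
longest decreasing subsequence is the larger block. -/
theorem CorrespondsTo.length_shape (h : CorrespondsTo π c₁ c₂) :
    (shape π).length = max c₁ c₂ := by
  apply le_antisymm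
  · obtain ⟨S, hS, hc⟩ := exists_decreasingOn π
    rw [← hc, le_max_iff]
    by_cases hS' : ∀ p ∈ S, (p : ℕ) < c₁
    · left
      rw [← h.card_bottoms]
      exact Finset.card_le_card fun p hp => by simpa using hS' p hp
    · right
      push Not at hS'
      obtain ⟨q, hq, hqc⟩ := hS'
      refine (Finset.card_le_card fun p hp => ?_).trans h.card_tops.le
      rw [Finset.mem_filter]
      refine ⟨Finset.mem_univ _, fun hpc => ?_⟩
      have := (h.lt_and_lt_iff p q).2 ⟨hpc, hqc.not_gt⟩
      exact (hS p hp q hq this.1).not_gt this.2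
  · have key : ∀ (P : Fin n → Prop) [DecidablePred P],
        (∀ p q, P p → P q → ¬ ((p : ℕ) < c₁ ∧ ¬ (q : ℕ) < c₁)) →
        (Finset.univ.filter P).card ≤ (shape π).length := by
      intro P _ hP
      refine DecreasingOn.card_le fun p hp q hq hpq => ?_
      by_contra hlt
      exact hP p q (Finset.mem_filter.1 hp).2 (Finset.mem_filter.1 hq).2
        ((h.lt_and_lt_iff p q).1 ⟨hpq, (not_lt.1 hlt).lt_of_ne (π.injective.ne hpq.ne)⟩)
    refine max_le ?_ ?_
    · exact h.card_bottoms.symm.le.trans (key _ (by tauto))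
    · exact h.card_tops.symm.le.trans (key _ (by tauto))

end Minimal

/-! ### Inversion excess as a deficit of noninversions -/

section TwoColumnShapes

variable {n r s : ℕ} {lam : YoungDiagram}

theorem twoColumn_data (h : lam.transpose.rowLens = [s, r]) :
    lam.rowLen 0 = 2 ∧ lam.colLen 0 = s ∧ lam.card = r + s ∧ 0 < r ∧ r ≤ s := by
  have hlen : lam.rowLen 0 = 2 := by
    rw [← YoungDiagram.colLen_transpose, ← YoungDiagram.length_rowLens, h]
    rfl
  have hcols : [lam.colLen 0, lam.colLen 1] = [s, r] := by
    rw [← h, YoungDiagram.rowLens, YoungDiagram.colLen_transpose, hlen]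
    simp [List.range_succ]
  simp only [List.cons.injEq, and_true] at hcols
  obtain ⟨h₀, h₁⟩ := hcols
  refine ⟨hlen, h₀, ?_, ?_, ?_⟩
  · have hcells : lam.cells = lam.col 1 ∪ lam.col 0 := by
      ext ⟨i, j⟩
      simp only [YoungDiagram.mem_cells, Finset.mem_union, YoungDiagram.mem_col_iff]
      refine ⟨fun hij => ?_, fun h => h.elim And.left And.left⟩
      simp only [hij, true_and]
      have := (YoungDiagram.mem_iff_lt_rowLen.1 hij).trans_le (lam.rowLen_anti 0 i (Nat.zero_le i))
      omega
    have hdisj : Disjoint (lam.col 1) (lam.col 0) := by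
      rw [Finset.disjoint_left]
      intro c hc hc'
      have := (YoungDiagram.mem_col_iff.1 hc).2
      have := (YoungDiagram.mem_col_iff.1 hc').2
      omega
    change lam.cells.card = _
    rw [hcells, Finset.card_union_of_disjoint hdisj, ← YoungDiagram.colLen_eq_card,
      ← YoungDiagram.colLen_eq_card, h₀, h₁]
  · exact YoungDiagram.pos_of_mem_rowLens lam.transpose r (by simp [h])
  · rw [← h₀, ← h₁]
    exact lam.colLen_anti 0 1 (Nat.zero_le 1)

theorem length_shape_of_mem (h : lam.transpose.rowLens = [s, r]) {σ : Equiv.Perm (Fin n)}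
    (hσ : σ ∈ permsOfShape n lam) : (shape σ).length = s := by
  rw [show shape σ = _ from hσ, YoungDiagram.length_rowLens, (twoColumn_data h).2.1]

theorem avoids123_of_mem (h : lam.transpose.rowLens = [s, r]) {σ : Equiv.Perm (Fin n)}
    (hσ : σ ∈ permsOfShape n lam) : Avoids123 σ := by
  apply avoids123_of_headD_le
  obtain ⟨h₁, h₂, -, h₃, h₄⟩ := twoColumn_data h
  obtain ⟨m, hm⟩ : ∃ m, lam.colLen 0 = m + 1 := ⟨s - 1, by omega⟩
  rw [show shape σ = _ from hσ, YoungDiagram.rowLens, hm, List.range_succ_eq_map]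
  simp [h₁]

/-- Here σ is a witness that λ occurs as a shape: π and σ have the same number of rows and at most
two columns, hence the same shape. -/
theorem CorrespondsTo.mem_permsOfShape (h : lam.transpose.rowLens = [s, r])
    {σ π : Equiv.Perm (Fin n)} (hσ : σ ∈ permsOfShape n lam) {c₁ c₂ : ℕ}
    (hπ : CorrespondsTo π c₁ c₂) (hc : max c₁ c₂ = s) : π ∈ permsOfShape n lam := by
  change shape π = _
  rw [← show shape σ = _ from hσ]
  refine shape_eq_of_avoids123 hπ.avoids123 (avoids123_of_mem h hσ) ?_
  rw [hπ.length_shape, length_shape_of_mem h hσ, hc]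

/-- The layered permutation with blocks r and s has rs noninversions, the most possible, so it
attains the minimum; both sides count all pairs. -/
theorem minInv_add (h : lam.transpose.rowLens = [s, r]) (hn : lam.card = n)
    {σ : Equiv.Perm (Fin n)} (hσ : σ ∈ permsOfShape n lam) :
    minInv n lam + r * s = inv σ + coinv σ := by
  obtain ⟨-, -, hcard, hr, hrs⟩ := twoColumn_data h
  obtain ⟨π, hπ⟩ := exists_correspondsTo (n := n) (c₁ := r) (c₂ := s) hr (by omega) (by omega)
  have hπm := hπ.mem_permsOfShape h hσ (max_eq_right hrs)
  have hmin : minInv n lam = inv π := by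
    refine IsLeast.csInf_eq ⟨⟨π, hπm, rfl⟩, ?_⟩
    rintro _ ⟨τ, hτ, rfl⟩
    have h₁ := (inv_add_coinv τ).trans (inv_add_coinv π).symm
    have h₂ : coinv τ ≤ r * s :=
      ((avoids123_of_mem h hτ).coinv_bounds (by omega) (length_shape_of_mem h hτ)).1
    rw [hπ.coinv_eq] at h₁
    omega
  rw [hmin, ← hπ.coinv_eq, inv_add_coinv, inv_add_coinv]

theorem mem_permsOfShapeExtra_iff (h : lam.transpose.rowLens = [s, r]) (hn : lam.card = n)
    {σ : Equiv.Perm (Fin n)} {Δ : ℕ} : σ ∈ permsOfShapeExtra n lam Δ ↔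
      σ ∈ permsOfShape n lam ∧ coinv σ + Δ = r * s := by
  refine and_congr_right fun hσ => ?_
  have := minInv_add h hn hσ
  omega

end TwoColumnShapes

/-! ### Recovering the jump partition from its action -/

section Uniqueness

variable {n c₁ c₂ : ℕ} {π σ : Equiv.Perm (Fin n)} {J : PartitionPair}

theorem colLen_le_card (μ : YoungDiagram) (j : ℕ) : μ.colLen j ≤ μ.card := by
  rw [YoungDiagram.colLen_eq_card]
  exact Finset.card_le_card (Finset.filter_subset _ _)

theorem act_lt_act (hπ : CorrespondsTo π c₁ c₂) (hJ : J.IsJumpPartition c₁ c₂)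
    {i k j l : ℕ} (hik : i + k + 1 = c₁) (hjl : j + l + 1 = c₂) (hμ : (i, j) ∉ J.inner)
    (hν : (k, l) ∉ J.outer) {p q : Fin n} (hp : (p : ℕ) + i + 1 = c₁ + J.inner.rowLen i)
    (hq : (q : ℕ) + J.inner.colLen j = c₁ + j) : p < q ∧ J.act c₁ π p < J.act c₁ π q := by
  have h₁ := act_apply_bottom hπ hJ hik p hp
  have h₂ := act_apply_top hπ hJ hjl q hq
  have h₃ := YoungDiagram.mem_iff_lt_rowLen.not.1 hμ
  have h₄ := YoungDiagram.mem_iff_lt_colLen.not.1 hμ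
  have h₅ := YoungDiagram.mem_iff_lt_rowLen.not.1 hν
  have h₆ := YoungDiagram.mem_iff_lt_colLen.not.1 hν
  rw [Fin.lt_def, Fin.lt_def]
  omega

/-- Every displaced bottom starts a noninversion and every displaced top ends one. Avoidance of 123
turns the former into left-to-right minima; the latter cannot be such. -/
theorem mem_leftMinima_act (hπ : CorrespondsTo π c₁ c₂) (hJ : J.IsJumpPartition c₁ c₂)
    (h₁ : J.size < c₁) (h₂ : J.size < c₂) (hA : Avoids123 (J.act c₁ π)) (p : Fin n) :
    p ∈ leftMinima (J.act c₁ π) ↔ ∃ i < c₁, (p : ℕ) + i + 1 = c₁ + J.inner.rowLen i := by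
  have hn := hπ.2.2.1
  have hbottom : ∀ p : Fin n, (∃ i < c₁, (p : ℕ) + i + 1 = c₁ + J.inner.rowLen i) →
      p ∈ leftMinima (J.act c₁ π) := by
    rintro p ⟨i, hi, hp⟩
    have hi' := J.inner.rowLen_anti 0 i (Nat.zero_le i)
    have hμ := hJ.1.2
    set j := J.inner.rowLen i with hj
    have hij : (i, j) ∉ J.inner := by
      rw [YoungDiagram.mem_iff_lt_rowLen]
      omega
    -- The top j = μ_i is the first one to the right of bottom i. If ν made it smaller in value,
    -- then ν_k + μ_i ≥ c₂ for k = c₁ − 1 − i, more than |J| allows.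
    have hkl : (c₁ - 1 - i, c₂ - 1 - j) ∉ J.outer := by
      rw [YoungDiagram.mem_iff_lt_rowLen]
      have := rowLen_le_card J.outer (c₁ - 1 - i)
      have := rowLen_le_card J.inner i
      rw [PartitionPair.size] at h₂
      omega
    have h := act_lt_act (p := p) (q := ⟨c₁ + j - J.inner.colLen j, by omega⟩) hπ hJ (by omega)
      (by omega) hij hkl hp (by
        have := J.inner.colLen_anti 0 j (Nat.zero_le j)
        have := hJ.1.1
        simp only
        omega)
    exact hA.mem_leftMinima h.1 h.2
  refine ⟨fun hp => ?_, hbottom p⟩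
  rcases exists_position hn hJ.1.2.le hJ.1.1 p with h | ⟨j, hj, hq⟩
  · exact h
  · exfalso
    -- Dually, bottom i is the nearest one to the left of top j; it exists and stays smaller because
    -- |J| < c₁.
    set i := J.inner.colLen j with hi
    have hij : (i, j) ∉ J.inner := by
      rw [YoungDiagram.mem_iff_lt_colLen]
      omega
    have hic := colLen_le_card J.inner j
    have hkc := colLen_le_card J.outer (c₂ - 1 - j)
    rw [PartitionPair.size] at h₁
    have hkl : (c₁ - 1 - i, c₂ - 1 - j) ∉ J.outer := by
      rw [YoungDiagram.mem_iff_lt_colLen]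
      omega
    have hi' := J.inner.rowLen_anti 0 i (Nat.zero_le i)
    have hμ := hJ.1.2
    have h := act_lt_act (p := ⟨c₁ - 1 - i + J.inner.rowLen i, by omega⟩) (q := p) hπ hJ
      (by omega) (by omega) hij hkl (by simp only; omega) hq
    exact notMem_leftMinima.2 ⟨_, h⟩ hp

theorem exists_bottoms_act (hπ : CorrespondsTo π c₁ c₂) (hJ : J.IsJumpPartition c₁ c₂)
    (h₁ : J.size < c₁) (h₂ : J.size < c₂) (hA : Avoids123 (J.act c₁ π)) :
    ∃ b : Fin c₁ → Fin n, StrictAnti b ∧ Set.range b = leftMinima (J.act c₁ π) ∧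
      ∀ i k : Fin c₁, (i : ℕ) + k + 1 = c₁ → (b i : ℕ) + i + 1 = c₁ + J.inner.rowLen i ∧
        (J.act c₁ π (b i) : ℕ) = i + J.outer.rowLen k := by
  have hn := hπ.2.2.1
  have hμ := hJ.1.2
  have hlt : ∀ i : Fin c₁, c₁ - 1 - i + J.inner.rowLen i < n := by
    intro i
    have := J.inner.rowLen_anti 0 i (Nat.zero_le i)
    omega
  have hb : ∀ i : Fin c₁, c₁ - 1 - i + J.inner.rowLen i + i + 1 = c₁ + J.inner.rowLen i := by
    intro i
    omega
  refine ⟨fun i => ⟨_, hlt i⟩, ?_, ?_, fun i k hik => ⟨hb i, act_apply_bottom hπ hJ hik _ (hb i)⟩⟩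
  · intro i j hij
    have := J.inner.rowLen_anti i j (Fin.le_def.1 hij.le)
    rw [Fin.lt_def] at hij ⊢
    simp only
    omega
  · ext p
    rw [Finset.mem_coe, mem_leftMinima_act hπ hJ h₁ h₂ hA, Set.mem_range]
    constructor
    · rintro ⟨i, rfl⟩
      exact ⟨i, i.2, hb i⟩
    · rintro ⟨i, hi, hp⟩
      exact ⟨⟨i, hi⟩, Fin.ext (by simp only; omega)⟩

theorem eq_of_rowLen_eq {μ ν : YoungDiagram} {c : ℕ} (hμ : μ.colLen 0 ≤ c) (hν : ν.colLen 0 ≤ c)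
    (h : ∀ i < c, μ.rowLen i = ν.rowLen i) : μ = ν := by
  ext ⟨i, j⟩
  rw [YoungDiagram.mem_cells, YoungDiagram.mem_cells, YoungDiagram.mem_iff_lt_rowLen,
    YoungDiagram.mem_iff_lt_rowLen]
  rcases lt_or_ge i c with hi | hi
  · rw [h i hi]
  · rw [rowLen_eq_zero (hμ.trans hi), rowLen_eq_zero (hν.trans hi)]

/-- Both enumerations of bottoms are strictly decreasing with the same range, so they coincide;
positions then give the rows of μ and values those of ν. -/
theorem jump_unique {c₁' c₂' : ℕ} {π' : Equiv.Perm (Fin n)} {J' : PartitionPair}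
    (hπ : CorrespondsTo π c₁ c₂) (hJ : J.IsJumpPartition c₁ c₂)
    (h₁ : J.size < c₁) (h₂ : J.size < c₂)
    (hπ' : CorrespondsTo π' c₁' c₂') (hJ' : J'.IsJumpPartition c₁' c₂')
    (h₁' : J'.size < c₁') (h₂' : J'.size < c₂') (hA : Avoids123 (J.act c₁ π))
    (hJJ' : J'.act c₁' π' = J.act c₁ π) : π' = π ∧ J' = J := by
  obtain ⟨b, hb, hbB, hbv⟩ := exists_bottoms_act hπ hJ h₁ h₂ hA
  obtain ⟨b', hb', hbB', hbv'⟩ := exists_bottoms_act hπ' hJ' h₁' h₂' (hJJ' ▸ hA)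
  rw [hJJ'] at hbB' hbv'
  have hc : c₁' = c₁ := by
    have h := Set.ncard_range_of_injective hb.injective
    have h' := Set.ncard_range_of_injective hb'.injective
    rw [hbB] at h
    rw [hbB', h] at h'
    simpa using h'.symm
  subst hc
  have hc : c₂' = c₂ := by
    have h := hπ.2.2.1
    have h' := hπ'.2.2.1
    omega
  subst hc
  have hbb : b' = b := by
    -- Reversing the index makes both sequences increasing, as `StrictMono.range_inj` requires.
    have : (fun i => b' (Fin.rev i)) = fun i => b (Fin.rev i) := by
      refine (StrictMono.range_inj (fun i j hij => hb' (Fin.rev_lt_rev.2 hij))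
        (fun i j hij => hb (Fin.rev_lt_rev.2 hij))).1 ?_
      change Set.range (b' ∘ Fin.rev) = Set.range (b ∘ Fin.rev)
      rw [Fin.rev_surjective.range_comp, Fin.rev_surjective.range_comp, hbB, hbB']
    funext i
    simpa using congrFun this i.rev
  subst hbb
  refine ⟨hπ'.eq hπ, PartitionPair.ext (eq_of_rowLen_eq hJ'.1.1 hJ.1.1 fun i hi => ?_)
    (eq_of_rowLen_eq hJ'.2.1 hJ.2.1 fun i hi => ?_)⟩
  · have h := hbv ⟨i, hi⟩ (Fin.rev ⟨i, hi⟩) (by simp only [Fin.val_rev]; omega)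
    have h' := hbv' ⟨i, hi⟩ (Fin.rev ⟨i, hi⟩) (by simp only [Fin.val_rev]; omega)
    have := h.1.symm.trans h'.1
    simp only at this
    omega
  · have h := hbv (Fin.rev ⟨i, hi⟩) ⟨i, hi⟩ (by simp only [Fin.val_rev]; omega)
    have h' := hbv' (Fin.rev ⟨i, hi⟩) ⟨i, hi⟩ (by simp only [Fin.val_rev]; omega)
    have := h.2.symm.trans h'.2
    simp only at this
    omega

end Uniqueness

/-- The block sizes are the numbers of left-to-right minima and of other positions of σ; as Δ < r
they are r and s in some order, so the layered π is minimal. The row bounds hold since |J| = Δ < r ≤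
c₂, and validity is automatic from J(π) = σ. -/
theorem exists_validJump {n r s Δ : ℕ} {lam : YoungDiagram} (hlam : lam.card = n)
    (hconj : lam.transpose.rowLens = [s, r]) (hΔ : Δ < r) {σ : Equiv.Perm (Fin n)}
    (hσ : σ ∈ permsOfShapeExtra n lam Δ) :
    ∃ π J, π ∈ permsOfShapeExtra n lam 0 ∧ IsValidJump π J Δ σ := by
  obtain ⟨-, -, hcard, hr, hrs⟩ := twoColumn_data hconj
  obtain ⟨hσm, hσΔ⟩ := (mem_permsOfShapeExtra_iff hconj hlam).1 hσ
  have hA := avoids123_of_mem hconj hσm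
  have hB := (hA.coinv_bounds (by omega) (length_shape_of_mem hconj hσm)).2 Δ hΔ hσΔ
  obtain ⟨b, t, hs, hb⟩ := hA.exists_isSplit rfl rfl
  have hsize := hs.size_jump_add_coinv fun i => (hb _).2 ⟨i, rfl⟩
  generalize (leftMinima σ).card = c₁ at *
  generalize (leftMinima σ)ᶜ.card = c₂ at *
  have hprod : c₁ * c₂ = r * s := by
    rcases hB with ⟨rfl, rfl⟩ | ⟨rfl, rfl⟩
    exacts [mul_comm _ _, rfl]
  obtain ⟨π, hπ⟩ := exists_correspondsTo (n := n) (c₁ := c₁) (c₂ := c₂) (by omega) (by omega)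
    (by omega)
  have hπm := hπ.mem_permsOfShape hconj hσm (by omega)
  have hJΔ : hs.jump.size = Δ := by omega
  have hJ : hs.jump.IsJumpPartition c₁ c₂ := by
    have h₁ := rowLen_le_card hs.jump.inner 0
    have h₂ := rowLen_le_card hs.jump.outer 0
    rw [PartitionPair.size] at hJΔ
    exact ⟨⟨colLen_crossDiagram_le hs.anti hs.mono 0, by omega⟩,
      colLen_crossDiagram_le hs.anti_rev hs.mono_rev 0, by omega⟩
  have hact := hs.act_jump hπ hJ
  refine ⟨π, hs.jump, (mem_permsOfShapeExtra_iff hconj hlam).2 ⟨hπm, ?_⟩, c₁, c₂, hπ, hJ, hJΔ, ?_,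
    hact.symm⟩
  · rw [hπ.coinv_eq, hprod, add_zero]
  · rw [hact]
    exact (show shape σ = _ from hσm).trans (show shape π = _ from hπm).symm

end TwoColumn

theorem mainTheorem3 (n : ℕ) (lam : YoungDiagram) (hlam : lam.card = n) (s r : ℕ)
    (hconj : lam.transpose.rowLens = [s, r]) (Δ : ℕ) (hΔ : Δ < r)
    (σ : Equiv.Perm (Fin n)) (hσ : σ ∈ TwoColumn.permsOfShapeExtra n lam Δ) :
    ∃! p : Equiv.Perm (Fin n) × TwoColumn.PartitionPair,
      p.1 ∈ TwoColumn.permsOfShapeExtra n lam 0 ∧ TwoColumn.IsValidJump p.1 p.2 Δ σ := by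
  -- From max(c₁, c₂) = s and c₁ + c₂ = r + s the smaller block has size r, so Δ is below both block
  -- sizes.
  have hlt : ∀ (π : Equiv.Perm (Fin n)) (c₁ c₂ : ℕ),
      π ∈ TwoColumn.permsOfShapeExtra n lam 0 → TwoColumn.CorrespondsTo π c₁ c₂ → r ≤ c₁ ∧ r ≤ c₂ := by
    intro π c₁ c₂ hπ hc
    have h₁ := TwoColumn.length_shape_of_mem hconj hπ.1
    rw [hc.length_shape] at h₁
    have h₂ := (TwoColumn.twoColumn_data hconj).2.2.1
    have h₃ := hc.2.2.1
    omega
  obtain ⟨π, J, hπ, hv⟩ := TwoColumn.exists_validJump hlam hconj hΔ hσ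
  refine ⟨(π, J), ⟨hπ, hv⟩, ?_⟩
  rintro ⟨π', J'⟩ ⟨hπ', c₁', c₂', hc', hJ', hs', -, hσ'⟩
  obtain ⟨c₁, c₂, hc, hJ, hs, -, rfl⟩ := hv
  have hr := hlt π c₁ c₂ hπ hc
  have hr' := hlt π' c₁' c₂' hπ' hc'
  obtain ⟨rfl, rfl⟩ := TwoColumn.jump_unique hc hJ (by omega) (by omega) hc' hJ' (by omega)
    (by omega) (TwoColumn.avoids123_of_mem hconj hσ.1) hσ'.symm
  rfl
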